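/- Let $\mathcal U,\mathcal Y$ be complex Hilbert spaces and let $S\in\mathcal S(\mathcal U,\mathcal Y)$, i.e. $S$ is a holomorphic function on the open unit disk $\mathbb D$ whose values are contractions in $\mathcal L(\mathcal U,\mathcal Y)$. Let $H^2(\mathcal Y)$ be the Hardy space of holomorphic $\mathcal Y$-valued functions on $\mathbb D$ with square-summable Taylor coefficients, and let $$\mathcal H(S)=\Big\{f\in H^2(\mathcal Y):\ \|f\|_{\mathcal H(S)}^2:=\sup_{g\in H^2(\mathcal U)}\big\{\|f+Sg\|^2_{H^2(\mathcal Y)}-\|g\|^2_{H^2(\mathcal U)}\big\}<\infty\Big\}.$$ (1) $\mathcal H(S)$ is a linear space and, with the norm above, a reproducing kernel Hilbert space of $\mathcal Y$-valued functions on $\mathbb D$, with reproducing kernel $$K_S(z,w)=\frac{I-S(z)S(w)^*}{1-z\overline w}.$$ (2) $\mathcal H(S)$ is invariant under the backward shift $R_0\colon f(z)\mapsto [f(z)-f(0)]/z$ (with value $f'(0)$ at $z=0$), and $$\|R_0f\|^2_{\mathcal H(S)}\le\|f\|^2_{\mathcal H(S)}-\|f(0)\|^2_{\mathcal Y}\qquad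 (f\in\mathcal H(S)).$$ Equality holds here for all $f\in\mathcal H(S)$ if and only if, for every $u\in\mathcal U$, $S(\cdot)u\in\mathcal H(S)$ implies $S(\cdot)u\equiv 0$. (3) For every $u\in\mathcal U$ the function $R_0(Su)$ is in $\mathcal H(S)$. The map $\tau\colon\mathcal U\to\mathcal H(S)$, $\tau\colon u\mapsto R_0(Su)=\frac{S(z)-S(0)}{z}u$, is a bounded operator, and the adjoint of $R_0$ on $\mathcal H(S)$ is given by $$(R_0^*f)(z)=zf(z)-S(z)\,\tau^*(f),\qquad \|R_0^*f\|^2_{\mathcal H(S)}=\|f\|^2_{\mathcal H(S)}-\|\tau^*(f)\|^2_{\mathcal U}\qquad (f\in\mathcal H(S)).$$ (4) Let $\mathbf e(0)\colon\mathcal H(S)\to\mathcal Y$, $f\mapsto f(0)$. The colligation matrix $$\mathbf U_S=\begin{bmatrix}A_S&B_S\\ C_S&D_S\end{bmatrix}:=\begin{bmatrix}R_0&\tau\\ \mathbf e(0)&S(0)\end{bmatrix}\colon \mathcal H(S)\oplus\mathcal U\to\mathcal H(S)\oplus\mathcal Y$$ is coisometric, and $S$ is its characteristic function: for all $z\in\mathbb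 D$, $I-zA_S$ is invertible and $$S(z)=D_S+zC_S(I-zA_S)^{-1}B_S.$$ (5) A bounded operator $T$ on a complex Hilbert space $\mathcal X$ is unitarily equivalent to the operator $R_0$ on $\mathcal H(S)$ for some Hilbert spaces $\mathcal U,\mathcal Y$ and some $S\in\mathcal S(\mathcal U,\mathcal Y)$ if and only if $T$ is a completely non-isometric contraction, i.e. $$\|T\|\le 1\quad\text{and}\quad \bigcap_{n\ge0}\{x\in\mathcal X:\ \|T^nx\|=\|x\|\}=\{0\}.$$ -/

import Mathlib

open Complex.UnitDisc

namespace DeBrangesRovnyak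

noncomputable section

/-- The extension by zero to `ℂ` of a function on the open unit disk; it is only ever used at
points of the disk, and serves to express holomorphy and derivatives there. -/
def diskExt {E : Type*} [Zero E] (f : 𝔻 → E) : ℂ → E :=
  Function.extend ((↑) : 𝔻 → ℂ) f 0

/-- `f` is holomorphic on the open unit disk. -/
def IsHolo {E : Type*} [NormedAddCommGroup E] [NormedSpace ℂ E] (f : 𝔻 → E) : Prop :=
  DifferentiableOn ℂ (diskExt f) (Metric.ball (0 : ℂ) 1)

/-- The `n`-th Taylor coefficient of `f` at the origin. -/
def taylorCoeff {E : Type*} [NormedAddCommGroup E] [NormedSpace ℂ E] (f : 𝔻 → E) (n : ℕ) : E :=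
  ((n.factorial : ℂ)⁻¹) • iteratedDeriv n (diskExt f) 0

/-- Membership in the Hardy space `H²(E)`: holomorphic on the disk, with square-summable Taylor
coefficients. -/
def MemH2 {E : Type*} [NormedAddCommGroup E] [NormedSpace ℂ E] (f : 𝔻 → E) : Prop :=
  IsHolo f ∧ Summable fun n : ℕ => ‖taylorCoeff f n‖ ^ 2

/-- The squared norm of the Hardy space `H²(E)`. -/
def h2NormSq {E : Type*} [NormedAddCommGroup E] [NormedSpace ℂ E] (f : 𝔻 → E) : ℝ :=
  ∑' n : ℕ, ‖taylorCoeff f n‖ ^ 2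

/-- The backward shift (difference quotient) `f ↦ (f(z) - f(0)) / z`; at `z = 0` its value is the
derivative `f'(0)`, which removes the singularity. -/
def backwardShift {E : Type*} [NormedAddCommGroup E] [NormedSpace ℂ E] (f : 𝔻 → E) : 𝔻 → E :=
  fun z => dslope (diskExt f) 0 (z : ℂ)

section Space

variable {U Y : Type*} [NormedAddCommGroup U] [InnerProductSpace ℂ U]
  [NormedAddCommGroup Y] [InnerProductSpace ℂ Y]

/-- The Schur class `𝒮(U, Y)`: holomorphic functions on the disk whose values are contractions
from `U` to `Y`. -/
def IsSchur (S : 𝔻 → U →L[ℂ] Y) : Prop :=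
  IsHolo S ∧ ∀ z, ‖S z‖ ≤ 1

/-- The numbers `‖f + S g‖² - ‖g‖²` (norms in `H²(Y)` and `H²(U)`), where `g` runs over
`H²(U)`. -/
def defects (S : 𝔻 → U →L[ℂ] Y) (f : 𝔻 → Y) : Set ℝ :=
  {r | ∃ g : 𝔻 → U, MemH2 g ∧ r = h2NormSq (fun z => f z + S z (g z)) - h2NormSq g}

/-- The de Branges–Rovnyak space `ℋ(S)` as a set of functions on the disk: those `f ∈ H²(Y)` for
which the supremum of `‖f + S g‖² - ‖g‖²` over `g ∈ H²(U)` is finite. -/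
def dbrSpace (S : 𝔻 → U →L[ℂ] Y) : Set (𝔻 → Y) :=
  {f | MemH2 f ∧ BddAbove (defects S f)}

/-- The squared `ℋ(S)`-norm of `f ∈ ℋ(S)`. -/
def dbrNormSq (S : 𝔻 → U →L[ℂ] Y) (f : 𝔻 → Y) : ℝ :=
  sSup (defects S f)

/-- `H` is the set of functions `ℋ(S)`, equipped with a Hilbert space structure whose norm is the
`ℋ(S)`-norm and whose vector operations and point evaluations are the pointwise ones (the last
point, with continuity of point evaluations, being the content of Mathlib's class `RKHS`).
By polarization such an `H` is unique up to a unique unitary map preserving the underlying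
functions. -/
def IsDBRSpace (S : 𝔻 → U →L[ℂ] Y) (H : Type*) [NormedAddCommGroup H] [InnerProductSpace ℂ H]
    [RKHS ℂ H 𝔻 Y] : Prop :=
  Set.range (fun f : H => (f : 𝔻 → Y)) = dbrSpace S ∧ ∀ f : H, ‖f‖ ^ 2 = dbrNormSq S f

/-- The de Branges–Rovnyak kernel `(I - S(z) S(w)*) / (1 - z w̄)`. -/
def dbrKernel [CompleteSpace U] [CompleteSpace Y] (S : 𝔻 → U →L[ℂ] Y) (z w : 𝔻) : Y →L[ℂ] Y :=
  (1 - (z : ℂ) * (starRingEnd ℂ) (w : ℂ))⁻¹ •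
    (ContinuousLinearMap.id ℂ Y - (S z).comp (ContinuousLinearMap.adjoint (S w)))

/-- Evaluation at `z` on a reproducing kernel Hilbert space of `Y`-valued functions. -/
def evalAt (H : Type*) [NormedAddCommGroup H] [InnerProductSpace ℂ H] [RKHS ℂ H 𝔻 Y] (z : 𝔻) :
    H →L[ℂ] Y :=
  (ContinuousLinearMap.proj z).comp (RKHS.coeCLM ℂ)

/-- `R` is the backward shift operator acting on the space of functions `H`. -/
def IsBackwardShift {H : Type*} [NormedAddCommGroup H] [InnerProductSpace ℂ H] [RKHS ℂ H 𝔻 Y]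
    (R : H →L[ℂ] H) : Prop :=
  ∀ f : H, ((R f : H) : 𝔻 → Y) = backwardShift (f : 𝔻 → Y)

end Space

section Colligation

variable {H U Y : Type*} [NormedAddCommGroup H] [InnerProductSpace ℂ H]
  [NormedAddCommGroup U] [InnerProductSpace ℂ U] [NormedAddCommGroup Y] [InnerProductSpace ℂ Y]

/-- The block operator matrix `[[A, B], [C, D]] : H ⊕ U → H ⊕ Y` between Hilbert space direct
sums. -/
def colligation (A : H →L[ℂ] H) (B : U →L[ℂ] H) (C : H →L[ℂ] Y) (D : U →L[ℂ] Y) :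
    WithLp 2 (H × U) →L[ℂ] WithLp 2 (H × Y) :=
  ((WithLp.prodContinuousLinearEquiv 2 ℂ H Y).symm : H × Y →L[ℂ] WithLp 2 (H × Y)).comp
    (((A.coprod B).prod (C.coprod D)).comp
      (WithLp.prodContinuousLinearEquiv 2 ℂ H U : WithLp 2 (H × U) →L[ℂ] H × U))

/-- The characteristic function `D + z C (I - z A)⁻¹ B` of a colligation; it is meaningful at `z`
when `I - z A` is invertible. -/
def charFun (A : H →L[ℂ] H) (B : U →L[ℂ] H) (C : H →L[ℂ] Y) (D : U →L[ℂ] Y) (z : ℂ) :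
    U →L[ℂ] Y :=
  D + z • C.comp ((Ring.inverse (1 - z • A)).comp B)

end Colligation

/-- A Hilbert space operator is coisometric if its adjoint is isometric, i.e. `V V* = I`. -/
def IsCoisometric {H K : Type*} [NormedAddCommGroup H] [InnerProductSpace ℂ H] [CompleteSpace H]
    [NormedAddCommGroup K] [InnerProductSpace ℂ K] [CompleteSpace K] (V : H →L[ℂ] K) : Prop :=
  V.comp (ContinuousLinearMap.adjoint V) = ContinuousLinearMap.id ℂ K

/-- Unitary equivalence of two Hilbert space operators. -/
def UnitarilyEquivalent {X H : Type*} [NormedAddCommGroup X] [InnerProductSpace ℂ X]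
    [NormedAddCommGroup H] [InnerProductSpace ℂ H] (T : X →L[ℂ] X) (R : H →L[ℂ] H) : Prop :=
  ∃ V : X ≃ₗᵢ[ℂ] H, ∀ x, V (T x) = R (V x)

/-- `T` is a completely non-isometric contraction. -/
def IsCNIContraction {X : Type*} [NormedAddCommGroup X] [InnerProductSpace ℂ X]
    (T : X →L[ℂ] X) : Prop :=
  ‖T‖ ≤ 1 ∧ (⋂ n : ℕ, {x : X | ‖(T ^ n) x‖ = ‖x‖}) = {0}

end

end DeBrangesRovnyak

open DeBrangesRovnyak

universe u v w t

/-!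
Functions in `H²(E)` are identified with their coefficient sequences in `ℓ²(ℕ, E)`, on which the
forward shift `fwd`, its adjoint (the backward shift), the constants `cst` and the evaluations `ev`
act. By Parseval's identity on circles, a Schur function `S` multiplies `H²(U)` contractively into
`H²(Y)`; call this operator `T`. It commutes with the forward shifts.

The key notion is that of an injective operator `J : H → K` with `J J* + T T* = I`
(`IsComplement`). For such `J` the column `k ↦ (J* k, T* k)` is an isometry, and it follows that
`‖J h + T g‖² - ‖g‖²` has supremum `‖h‖²` over `g`, and that the supremum is infinite at vectors
outside the range of `J`. So the de Branges–Rovnyak space is the range of `J` with the norm of `H`.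
Such a `J` exists (a square root of `I - T T*`), and conversely every realization of `ℋ(S)` as a
Hilbert space of functions arises from one (`IsDBRSpace.exists_isComplement`). The kernel formula is
then the operator identity evaluated against the Szegő kernel.

Since `ran J*` is dense in `H`, operators out of `H` can be defined on vectors `J* k`. The adjoint
of the colligation sends `(J* k, y)` to `(J* x, (T* x)(0))` with `x = fwd k + cst y`, and the
commutation of `T` with the shift makes this isometric. Thus the colligation is a coisometry `V`,
which gives both norm statements for `R₀` and `R₀*`. The kernel of `V` consists of the pairs
`(-S u, u)` with `S u ∈ ℋ(S)`, and equality holds in the norm inequality for `R₀` exactly when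
`ker V` is orthogonal to `H ⊕ 0`, that is, when all those `S u` vanish.

For a completely non-isometric contraction `T` on `X`, the output operator `C = (I - T* T)^{1/2}`
makes `W = [T; C]` an isometry, and `[W, I - W W*]` is a coisometric colligation. With `M` the
multiplication by its characteristic function and `J x = (C Tⁿ x)ₙ`, the operator
`Q = J J* + M M*` satisfies `Q = cst cst* + fwd Q fwd*`, hence `Q = I`. Complete non-isometry says
that `J` is injective, so `X` itself, embedded by `J`, is a de Branges–Rovnyak space with backward
shift `T`.
-/

namespace DeBrangesRovnyak

noncomputable section

open ContinuousLinearMap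
open scoped InnerProductSpace

/-! ### Complementary spaces of contractions -/

section Complement

variable {G H K L : Type*} [NormedAddCommGroup G] [InnerProductSpace ℂ G] [CompleteSpace G]
  [NormedAddCommGroup H] [InnerProductSpace ℂ H] [CompleteSpace H]
  [NormedAddCommGroup K] [InnerProductSpace ℂ K] [CompleteSpace K]
  [NormedAddCommGroup L] [InnerProductSpace ℂ L] [CompleteSpace L]

/-- `J` embeds `H` into `K` as the complementary space of the range of the contraction `T`:
`J` is injective and `J J* = I - T T*`. -/
structure IsComplement (T : G →L[ℂ] K) (J : H →L[ℂ] K) : Prop where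
  injective : Function.Injective J
  adjoint_apply : ∀ k, J (adjoint J k) + T (adjoint T k) = k

theorem denseRange_adjoint_of_injective {J : H →L[ℂ] K} (hJ : Function.Injective J) :
    DenseRange (adjoint J) := by
  have h : (LinearMap.range (adjoint J : K →ₗ[ℂ] H))ᗮ = ⊥ := by
    rw [Submodule.eq_bot_iff]
    intro x hx
    apply hJ
    rw [map_zero]
    apply ext_inner_left ℂ
    intro k
    rw [inner_zero_right, ← adjoint_inner_left]
    exact (Submodule.mem_orthogonal _ _).1 hx _ ⟨k, rfl⟩
  have h2 := (Submodule.topologicalClosure_eq_top_iff (K := LinearMap.range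
    (adjoint J : K →ₗ[ℂ] H))).2 h
  have h3 := (Submodule.dense_iff_topologicalClosure_eq_top).2 h2
  exact h3

/-- As `ran J*` is dense, a bounded operator on `H` can be prescribed on the vectors `J* k`. -/
theorem exists_comp_adjoint_eq {J : H →L[ℂ] K} (hJ : Function.Injective J) (X : K →L[ℂ] L)
    {C : ℝ} (h : ∀ k, ‖X k‖ ≤ C * ‖adjoint J k‖) :
    ∃ Z : H →L[ℂ] L, ∀ k, Z (adjoint J k) = X k :=
  ⟨(X : K →ₗ[ℂ] L).extendOfNorm (adjoint J : K →ₗ[ℂ] H), fun k =>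
    LinearMap.extendOfNorm_eq (f := (X : K →ₗ[ℂ] L)) (e := (adjoint J : K →ₗ[ℂ] H))
      (denseRange_adjoint_of_injective hJ) ⟨C, h⟩ k⟩

namespace IsComplement

variable {T : G →L[ℂ] K} {J : H →L[ℂ] K}

theorem norm_adjoint_sq (hJ : IsComplement T J) (k : K) :
    ‖adjoint J k‖ ^ 2 + ‖adjoint T k‖ ^ 2 = ‖k‖ ^ 2 := by
  have h := congrArg (fun x => RCLike.re (inner ℂ x k)) (hJ.adjoint_apply k)
  simp only [inner_add_left, map_add] at h
  rw [← adjoint_inner_right J, ← adjoint_inner_right T, inner_self_eq_norm_sq,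
    inner_self_eq_norm_sq, inner_self_eq_norm_sq] at h
  exact h

/-- `(h, g) ↦ J h + T g` is the adjoint of the isometry `k ↦ (J* k, T* k)`, hence a contraction. -/
theorem norm_add_sq_le (hJ : IsComplement T J) (h : H) (g : G) :
    ‖J h + T g‖ ^ 2 ≤ ‖h‖ ^ 2 + ‖g‖ ^ 2 := by
  set x := J h + T g
  have h1 : ‖x‖ ^ 2 =
      RCLike.re (inner ℂ h (adjoint J x)) + RCLike.re (inner ℂ g (adjoint T x)) := by
    rw [adjoint_inner_right, adjoint_inner_right, ← map_add, ← inner_add_left]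
    exact (inner_self_eq_norm_sq x).symm
  have h2 := hJ.norm_adjoint_sq x
  have h3 := re_inner_le_norm (𝕜 := ℂ) h (adjoint J x)
  have h4 := re_inner_le_norm (𝕜 := ℂ) g (adjoint T x)
  nlinarith [sq_nonneg (‖h‖ - ‖adjoint J x‖), sq_nonneg (‖g‖ - ‖adjoint T x‖)]

theorem norm_le (hJ : IsComplement T J) (h : H) : ‖J h‖ ≤ ‖h‖ := by
  have := hJ.norm_add_sq_le h 0
  simp only [map_zero, add_zero, norm_zero, ne_eq, OfNat.ofNat_ne_zero, not_false_eq_true,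
    zero_pow] at this
  exact le_of_sq_le_sq this (norm_nonneg _)

/-- Choosing `g = T* a` turns a bound of the defects of `f` into a bound of a functional. -/
theorem two_re_inner_le (hJ : IsComplement T J) {f : K} {c : ℝ}
    (hc : ∀ g, ‖f + T g‖ ^ 2 - ‖g‖ ^ 2 ≤ c) (a : K) :
    2 * RCLike.re (inner ℂ f a) ≤ c + ‖adjoint J a‖ ^ 2 := by
  have h1 := hc (adjoint T a)
  have h2 := hJ.norm_adjoint_sq a
  have h3 : 0 ≤ ‖f + T (adjoint T a) - a‖ ^ 2 := by positivity
  rw [@norm_sub_sq ℂ, inner_add_left, ← adjoint_inner_right, map_add, inner_self_eq_norm_sq] at h3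
  linarith

/-- If the defects of `f` are bounded, then `J* a ↦ ⟪f, a⟫` is a bounded functional, and its Riesz
representative is a preimage of `f`. -/
theorem mem_range_of_bddAbove (hJ : IsComplement T J) {f : K} {c : ℝ}
    (hc : ∀ g, ‖f + T g‖ ^ 2 - ‖g‖ ^ 2 ≤ c) : ∃ h, J h = f := by
  have hc0 : 0 ≤ c := by have := hc 0; simp at this; nlinarith [norm_nonneg f]
  have key : ∀ a, ‖inner ℂ f a‖ ≤ (c + 1) * ‖adjoint J a‖ := by
    intro a
    set s := ‖inner ℂ f a‖ with hs
    set d := ‖adjoint J a‖ with hd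
    -- rotate and scale `a` so that the inner product becomes real of any prescribed size
    have h1 : ∀ t : ℝ, 2 * t * s ^ 2 ≤ c + t ^ 2 * s ^ 2 * d ^ 2 := by
      intro t
      have := hJ.two_re_inner_le hc (((t : ℂ) * (starRingEnd ℂ) (inner ℂ f a)) • a)
      rw [inner_smul_right, map_smul, norm_smul, mul_assoc, mul_comm ((starRingEnd ℂ) _),
        RCLike.mul_conj, norm_mul, mul_pow, mul_pow] at this
      simp only [RCLike.norm_conj, ← hs, ← hd, Complex.norm_real, Real.norm_eq_abs, sq_abs] at this
      have e : RCLike.re ((t : ℂ) * ((s : ℂ)) ^ 2) = t * s ^ 2 := by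
        rw [← Complex.ofReal_pow, ← Complex.ofReal_mul]; exact Complex.ofReal_re _
      have e2 : 2 * (t * s ^ 2) ≤ c + t ^ 2 * (s ^ 2) * d ^ 2 := e ▸ this
      linarith
    have hs0 : 0 ≤ s := norm_nonneg _
    have hd0 : 0 ≤ d := norm_nonneg _
    rcases hd0.eq_or_lt with h0 | h0
    · rw [← h0, mul_zero]
      by_contra! hlt
      -- with `J* a = 0` the bound is linear in `t`, so it fails for large `t`
      have := h1 ((c + 1) / s ^ 2)
      have e : 2 * ((c + 1) / s ^ 2) * s ^ 2 = 2 * (c + 1) := by field_simp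
      rw [e, ← h0] at this
      linarith
    · have := h1 (1 / d ^ 2)
      have e : 2 * (1 / d ^ 2) * s ^ 2 - (1 / d ^ 2) ^ 2 * s ^ 2 * d ^ 2 = s ^ 2 / d ^ 2 := by
        field_simp; ring
      have h2 : s ^ 2 / d ^ 2 ≤ c := by linarith
      rw [div_le_iff₀ (by positivity)] at h2
      apply le_of_sq_le_sq _ (by positivity)
      nlinarith [sq_nonneg d]
  obtain ⟨Z, hZ⟩ := exists_comp_adjoint_eq hJ.injective (innerSL ℂ f) (C := c + 1)
    (by simpa using key)
  refine ⟨(InnerProductSpace.toDual ℂ H).symm Z, ?_⟩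
  apply ext_inner_right ℂ
  intro a
  rw [← adjoint_inner_right, InnerProductSpace.toDual_symm_apply, hZ, innerSL_apply_apply]

/-- The squared norm of the complementary space is the supremum of the defects. -/
theorem isLUB_defect (hJ : IsComplement T J) (h : H) :
    IsLUB (Set.range fun g => ‖J h + T g‖ ^ 2 - ‖g‖ ^ 2) (‖h‖ ^ 2) := by
  constructor
  · rintro _ ⟨g, rfl⟩
    have := hJ.norm_add_sq_le h g
    simp only
    linarith
  · intro c hc
    have hc' : ∀ g, ‖J h + T g‖ ^ 2 - ‖g‖ ^ 2 ≤ c := fun g => hc ⟨g, rfl⟩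
    have key : ∀ y : H, 2 * RCLike.re (inner ℂ h y) - ‖y‖ ^ 2 ≤ c := by
      intro y
      refine (denseRange_adjoint_of_injective hJ.injective).induction_on
        (p := fun y => 2 * RCLike.re (inner ℂ h y) - ‖y‖ ^ 2 ≤ c) y ?_ ?_
      · exact isClosed_le (by fun_prop) continuous_const
      · intro a
        have := hJ.two_re_inner_le hc' a
        rw [← adjoint_inner_right] at this
        linarith
    have := key h
    rw [inner_self_eq_norm_sq] at this
    linarith

theorem bddAbove_iff (hJ : IsComplement T J) (f : K) :
    BddAbove (Set.range fun g => ‖f + T g‖ ^ 2 - ‖g‖ ^ 2) ↔ ∃ h, J h = f := by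
  constructor
  · rintro ⟨c, hc⟩
    exact hJ.mem_range_of_bddAbove fun g => hc ⟨g, rfl⟩
  · rintro ⟨h, rfl⟩
    exact ⟨_, (hJ.isLUB_defect h).1⟩

/-- The range and the norm determine the complementary space: an injective operator with the
range of `J` and inducing the same norm on it satisfies the same operator identity. -/
theorem of_range_eq (hJ : IsComplement T J) {J' : L →L[ℂ] K} (hinj : Function.Injective J')
    (hrange : ∀ f, (∃ l, J' l = f) ↔ ∃ h, J h = f)
    (hnorm : ∀ l h, J' l = J h → ‖l‖ = ‖h‖) : IsComplement T J' := by
  choose Φ hΦ using fun l => (hrange (J' l)).1 ⟨l, rfl⟩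
  choose Ψ hΨ using fun h => (hrange (J h)).2 ⟨h, rfl⟩
  let e : L ≃ₗᵢ[ℂ] H :=
    { toFun := Φ
      invFun := Ψ
      left_inv := fun l => hinj (by rw [hΨ, hΦ])
      right_inv := fun h => hJ.injective (by rw [hΦ, hΨ])
      map_add' := fun a b => hJ.injective (by rw [hΦ, map_add, map_add, hΦ, hΦ])
      map_smul' := fun c a => hJ.injective (by
        rw [hΦ, map_smul, RingHom.id_apply, map_smul, hΦ])
      norm_map' := fun l => (hnorm l _ (hΦ l).symm).symm }
  have hadj : ∀ k, e (adjoint J' k) = adjoint J k := by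
    intro k
    apply ext_inner_left ℂ
    intro h
    obtain ⟨l, rfl⟩ := e.surjective h
    rw [e.inner_map_map, adjoint_inner_right, adjoint_inner_right]
    exact congrArg (fun x => inner ℂ x k) (hΦ l).symm
  refine ⟨hinj, fun k => ?_⟩
  rw [← hΦ (adjoint J' k)]
  change J (e (adjoint J' k)) + _ = _
  rw [hadj, hJ.adjoint_apply]

end IsComplement

/-- The square root of `I - A`, for self-adjoint `A ≤ I`. -/
theorem exists_mul_self_of_contraction {A : K →L[ℂ] K} (hA : IsSelfAdjoint A)
    (h : ∀ k, RCLike.re (inner ℂ (A k) k) ≤ ‖k‖ ^ 2) :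
    ∃ D : K →L[ℂ] K, adjoint D = D ∧ ∀ k, D (D k) = k - A k := by
  have hpos : 0 ≤ (1 - A : K →L[ℂ] K) := by
    rw [nonneg_iff_isPositive, isPositive_def']
    refine ⟨(IsSelfAdjoint.one _).sub hA, fun k => ?_⟩
    rw [reApplyInnerSelf_apply]
    change 0 ≤ RCLike.re (inner ℂ (k - A k) k)
    rw [inner_sub_left, map_sub, inner_self_eq_norm_sq]
    linarith [h k]
  refine ⟨CFC.sqrt (1 - A), ?_, fun k => ?_⟩
  · exact (IsSelfAdjoint.of_nonneg (CFC.sqrt_nonneg (1 - A))).adjoint_eq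
  · exact DFunLike.congr_fun (CFC.sqrt_mul_sqrt_self (1 - A) hpos) k

/-- The complementary space exists: it is the orthogonal complement of the kernel of the square
root of `I - T T*`, embedded by that square root. -/
theorem exists_isComplement (T : G →L[ℂ] K) (hT : ‖T‖ ≤ 1) :
    ∃ (M : Submodule ℂ K) (_ : CompleteSpace M) (J : M →L[ℂ] K), IsComplement T J := by
  obtain ⟨D, hDs, hD⟩ := exists_mul_self_of_contraction (A := T ∘L adjoint T)
    (by rw [isSelfAdjoint_iff', adjoint_comp, adjoint_adjoint]) (by
      intro k
      rw [comp_apply, ← adjoint_inner_right, inner_self_eq_norm_sq]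
      have : ‖adjoint T k‖ ≤ ‖k‖ := by
        have := (adjoint T).le_of_opNorm_le ((LinearIsometryEquiv.norm_map adjoint T).trans_le hT) k
        simpa using this
      gcongr)
  let M : Submodule ℂ K := (LinearMap.ker (D : K →ₗ[ℂ] K))ᗮ
  have hc : CompleteSpace M := (Submodule.isClosed_orthogonal _).completeSpace_coe
  have hmem : ∀ k, D k ∈ M := by
    intro k
    rw [Submodule.mem_orthogonal]
    intro x hx
    rw [← hDs, adjoint_inner_right]
    have : D x = 0 := hx
    rw [this, inner_zero_left]
  refine ⟨M, hc, D ∘L M.subtypeL, ⟨?_, fun k => ?_⟩⟩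
  · rw [injective_iff_map_eq_zero]
    intro x hx
    have h1 : (x : K) ∈ LinearMap.ker (D : K →ₗ[ℂ] K) := hx
    have h2 := (Submodule.mem_orthogonal _ _).1 x.2 _ h1
    exact Subtype.ext (inner_self_eq_zero.1 h2)
  · have : adjoint (D ∘L M.subtypeL) k = ⟨D k, hmem k⟩ := by
      apply ext_inner_left ℂ
      intro x
      rw [adjoint_inner_right, Submodule.coe_inner, comp_apply, ← adjoint_inner_right, hDs]
      rfl
    rw [this]
    change D (D k) + _ = _
    rw [hD, comp_apply, sub_add_cancel]

end Complement

/-! ### Shifts and evaluations on `ℓ²` -/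

section Shift

/-- Square-summable sequences in `E`, the coefficient model of the Hardy space `H²(E)`. -/
abbrev Ell2 (E : Type*) [NormedAddCommGroup E] := lp (fun _ : ℕ => E) 2

variable {E : Type*} [NormedAddCommGroup E]

theorem memℓp_two_iff {a : ℕ → E} : Memℓp a 2 ↔ Summable fun n => ‖a n‖ ^ 2 := by
  rw [memℓp_gen_iff (by norm_num)]
  simp

theorem Ell2.hasSum_norm_sq (a : Ell2 E) : HasSum (fun n => ‖a n‖ ^ 2) (‖a‖ ^ 2) := by
  simpa using lp.hasSum_norm (p := 2) (by norm_num) a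

theorem Ell2.norm_sq (a : Ell2 E) : ‖a‖ ^ 2 = ∑' n, ‖a n‖ ^ 2 :=
  (Ell2.hasSum_norm_sq a).tsum_eq.symm

variable [InnerProductSpace ℂ E]

/-- The sequence `(0, a 0, a 1, …)`. -/
def shiftSeq (a : ℕ → E) : ℕ → E
  | 0 => 0
  | n + 1 => a n

/-- The forward shift, an isometry of `ℓ²`. -/
def shift : Ell2 E →ₗᵢ[ℂ] Ell2 E where
  toFun a := ⟨shiftSeq a, memℓp_two_iff.2
    ((summable_nat_add_iff 1).1 (memℓp_two_iff.1 (lp.memℓp a)))⟩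
  map_add' a b := by
    ext n
    cases n with
    | zero => exact (add_zero (0 : E)).symm
    | succ n => rfl
  map_smul' c a := by
    ext n
    cases n with
    | zero => exact (smul_zero c).symm
    | succ n => rfl
  norm_map' a := by
    rw [← sq_eq_sq₀ (norm_nonneg _) (norm_nonneg _)]
    refine (Ell2.hasSum_norm_sq _).unique ?_
    refine (hasSum_nat_add_iff' 1).1 ?_
    simpa [shiftSeq] using Ell2.hasSum_norm_sq a

/-- The forward shift as a bounded operator. -/
def fwd : Ell2 E →L[ℂ] Ell2 E := shift.toContinuousLinearMap

@[simp] theorem fwd_zero (a : Ell2 E) : fwd a 0 = 0 := rfl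
@[simp] theorem fwd_succ (a : Ell2 E) (n : ℕ) : fwd a (n + 1) = a n := rfl

/-- The embedding of `E` as the constants, i.e. the sequences supported at `0`. -/
def cst : E →L[ℂ] Ell2 E := lp.singleContinuousLinearMap ℂ (fun _ => E) 2 0

@[simp] theorem cst_zero (y : E) : cst y 0 = y := by simp [cst]
@[simp] theorem cst_succ (y : E) (n : ℕ) : cst y (n + 1) = 0 := by simp [cst]

theorem norm_fwd_add_cst_sq (a : Ell2 E) (y : E) : ‖fwd a + cst y‖ ^ 2 = ‖a‖ ^ 2 + ‖y‖ ^ 2 := by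
  refine (Ell2.hasSum_norm_sq _).unique ?_
  refine (hasSum_nat_add_iff' 1).1 ?_
  simpa using Ell2.hasSum_norm_sq a

variable [CompleteSpace E]

@[simp] theorem adjoint_cst_apply (a : Ell2 E) : adjoint cst a = a 0 := by
  apply ext_inner_left ℂ
  intro y
  rw [adjoint_inner_right]
  exact lp.inner_single_left (𝕜 := ℂ) (G := fun _ : ℕ => E) 0 y a

@[simp] theorem adjoint_fwd_apply (a : Ell2 E) (n : ℕ) : adjoint fwd a n = a (n + 1) := by
  apply ext_inner_left ℂ
  intro y
  have h : fwd (lp.single 2 n y : Ell2 E) = lp.single 2 (n + 1) y := by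
    ext m
    cases m with
    | zero => simp [lp.single_apply]
    | succ m => simp [lp.single_apply, Pi.single_apply]
  rw [← lp.inner_single_left (𝕜 := ℂ) (G := fun _ => E) n y, adjoint_inner_right, h,
    lp.inner_single_left]

@[simp] theorem adjoint_fwd_fwd (a : Ell2 E) : adjoint fwd (fwd a) = a := by
  ext n; simp

@[simp] theorem adjoint_fwd_cst (y : E) : adjoint fwd (cst y) = 0 := by
  ext n; simp

@[simp] theorem adjoint_fwd_fwd_add_cst (a : Ell2 E) (y : E) : adjoint fwd (fwd a + cst y) = a := by
  ext n; simp

theorem fwd_adjoint_fwd_add (a : Ell2 E) : fwd (adjoint fwd a) + cst (a 0) = a := by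
  ext n; cases n <;> simp

theorem norm_adjoint_fwd_le : ‖(adjoint fwd : Ell2 E →L[ℂ] Ell2 E)‖ ≤ 1 := by
  refine opNorm_le_bound _ zero_le_one fun a => ?_
  have h := norm_fwd_add_cst_sq (adjoint fwd a) (a 0)
  rw [fwd_adjoint_fwd_add] at h
  rw [one_mul]
  refine le_of_sq_le_sq ?_ (norm_nonneg _)
  nlinarith [sq_nonneg ‖a 0‖]

theorem norm_smul_lt_one {A : Type*} [NormedRing A] [NormedAlgebra ℂ A] {b : A} (hb : ‖b‖ ≤ 1)
    (z : 𝔻) : ‖(z : ℂ) • b‖ < 1 := by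
  rw [norm_smul]
  nlinarith [z.norm_lt_one, norm_nonneg b, norm_nonneg (z : ℂ)]

theorem isUnit_one_sub_smul {A : Type*} [NormedRing A] [NormedAlgebra ℂ A] [CompleteSpace A]
    {b : A} (hb : ‖b‖ ≤ 1) (z : 𝔻) : IsUnit (1 - (z : ℂ) • b) :=
  isUnit_one_sub_of_norm_lt_one (norm_smul_lt_one hb z)

theorem hasSum_inverse_one_sub_smul {A : Type*} [NormedRing A] [NormedAlgebra ℂ A]
    [CompleteSpace A] {b : A} (hb : ‖b‖ ≤ 1) (z : 𝔻) :
    HasSum (fun n => (z : ℂ) ^ n • b ^ n) (Ring.inverse (1 - (z : ℂ) • b)) := by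
  rw [NormedRing.inverse_one_sub _ (norm_smul_lt_one hb z)]
  change HasSum _ (∑' n, ((z : ℂ) • b) ^ n)
  simpa [smul_pow] using (summable_geometric_of_norm_lt_one (norm_smul_lt_one hb z)).hasSum

/-- Evaluation at `z` of the function with a given coefficient sequence, `a ↦ ∑ zⁿ aₙ`; it is
expressed as the constant term of the resolvent of the backward shift. -/
def ev (z : 𝔻) : Ell2 E →L[ℂ] E :=
  adjoint cst ∘L Ring.inverse (1 - (z : ℂ) • adjoint fwd)

theorem adjoint_fwd_pow_apply (a : Ell2 E) (n m : ℕ) : ((adjoint fwd) ^ n) a m = a (n + m) := by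
  induction n generalizing a with
  | zero => simp
  | succ n ih =>
    rw [pow_succ]
    change ((adjoint fwd) ^ n) (adjoint fwd a) m = _
    rw [ih, adjoint_fwd_apply]
    rw [add_right_comm, add_assoc]

theorem hasSum_ev (z : 𝔻) (a : Ell2 E) : HasSum (fun n => (z : ℂ) ^ n • a n) (ev z a) := by
  have h := (hasSum_inverse_one_sub_smul (norm_adjoint_fwd_le (E := E)) z).mapL
    ((adjoint (cst : E →L[ℂ] Ell2 E)) ∘L (ContinuousLinearMap.apply ℂ (Ell2 E) a))
  convert! h using 1
  ext n
  change _ = adjoint cst ((z : ℂ) ^ n • ((adjoint fwd) ^ n) a)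
  rw [map_smul, adjoint_cst_apply, adjoint_fwd_pow_apply, add_zero]

/-- The defining resolvent equation of `ev`; multiplication by the coordinate, evaluation of
constants and the Szegő kernel are all consequences. -/
theorem ev_resolvent (z : 𝔻) (a : Ell2 E) : ev z a - (z : ℂ) • ev z (adjoint fwd a) = a 0 := by
  have h := Ring.inverse_mul_cancel _ (isUnit_one_sub_smul (norm_adjoint_fwd_le (E := E)) z)
  have h2 := congrArg (fun A : Ell2 E →L[ℂ] Ell2 E => adjoint cst (A a)) h
  change ev z (a - (z : ℂ) • adjoint fwd a) = adjoint cst a at h2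
  rwa [map_sub, map_smul, adjoint_cst_apply] at h2

@[simp] theorem ev_cst (z : 𝔻) (y : E) : ev z (cst y) = y := by
  simpa using ev_resolvent z (cst y)

@[simp] theorem ev_fwd (z : 𝔻) (a : Ell2 E) : ev z (fwd a) = (z : ℂ) • ev z a := by
  simpa [sub_eq_zero] using ev_resolvent z (fwd a)

@[simp] theorem ev_zero (a : Ell2 E) : ev 0 a = a 0 := by
  simpa using ev_resolvent 0 a

theorem adjoint_ev (z : 𝔻) (y : E) :
    adjoint (ev z) y = cst y + (starRingEnd ℂ (z : ℂ)) • fwd (adjoint (ev z) y) := by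
  apply ext_inner_left ℂ
  intro a
  rw [adjoint_inner_right, inner_add_right, inner_smul_right, ← adjoint_inner_left,
    ← adjoint_inner_left, adjoint_inner_right, adjoint_cst_apply, ← ev_resolvent z a,
    inner_sub_left, inner_smul_left]
  ring

/-- The Szegő kernel is the reproducing kernel of `H²`. -/
theorem ev_adjoint_ev (z w : 𝔻) (y : E) :
    ev z (adjoint (ev w) y) = (1 - (z : ℂ) * starRingEnd ℂ (w : ℂ))⁻¹ • y := by
  have h := congrArg (ev z) (adjoint_ev w y)
  rw [map_add, map_smul, ev_cst, ev_fwd] at h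
  set x := ev z (adjoint (ev w) y)
  have hne : 1 - (z : ℂ) * starRingEnd ℂ (w : ℂ) ≠ 0 := by
    intro h0
    have h1 : ‖(z : ℂ) * starRingEnd ℂ (w : ℂ)‖ = 1 := by
      rw [← sub_eq_zero.1 h0, norm_one]
    rw [norm_mul, RCLike.norm_conj] at h1
    nlinarith [z.norm_lt_one, w.norm_lt_one, norm_nonneg (z : ℂ), norm_nonneg (w : ℂ)]
  rw [eq_inv_smul_iff₀ hne, sub_smul, one_smul, mul_comm, mul_smul, sub_eq_iff_eq_add]
  exact h

end Shift

/-! ### Taylor coefficients on the disk and Parseval's identity -/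

section Taylor

theorem diskExt_coe {E : Type*} [Zero E] (f : 𝔻 → E) (z : 𝔻) : diskExt f (z : ℂ) = f z :=
  Complex.UnitDisc.coe_injective.extend_apply _ _ _

variable {E : Type*} [NormedAddCommGroup E] [NormedSpace ℂ E]

theorem IsHolo.hasSum_taylorCoeff [CompleteSpace E] {f : 𝔻 → E} (hf : IsHolo f) (z : 𝔻) :
    HasSum (fun n => (z : ℂ) ^ n • taylorCoeff f n) (f z) := by
  have h := Complex.hasSum_taylorSeries_on_ball hf (z := (z : ℂ)) (by simpa using z.norm_lt_one)
  rw [diskExt_coe] at h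
  refine h.congr_fun ?_
  intro n
  rw [taylorCoeff, smul_comm, sub_zero]

/-- The power series with coefficients `a`. -/
def coeffSeries (a : ℕ → E) : FormalMultilinearSeries ℂ ℂ E :=
  fun n => ContinuousMultilinearMap.mkPiRing ℂ (Fin n) (a n)

theorem one_le_radius_coeffSeries {f : 𝔻 → E} {a : ℕ → E}
    (h : ∀ z : 𝔻, HasSum (fun n => (z : ℂ) ^ n • a n) (f z)) : 1 ≤ (coeffSeries a).radius := by
  refine ENNReal.le_of_forall_nnreal_lt fun r hr => ?_
  have hr1 : (r : ℝ) < 1 := by exact_mod_cast hr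
  have hz : ‖((r : ℝ) : ℂ)‖ < 1 := by simpa using hr1
  have := (h (Complex.UnitDisc.mk _ hz)).summable.tendsto_atTop_zero.norm
  refine FormalMultilinearSeries.le_radius_of_tendsto _ (l := 0) ?_
  simpa [coeffSeries, norm_smul, mul_comm] using this

theorem hasFPowerSeriesOnBall_diskExt {f : 𝔻 → E} {a : ℕ → E}
    (h : ∀ z : 𝔻, HasSum (fun n => (z : ℂ) ^ n • a n) (f z)) :
    HasFPowerSeriesOnBall (diskExt f) (coeffSeries a) 0 1 where
  r_le := one_le_radius_coeffSeries h
  r_pos := one_pos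
  hasSum {y} hy := by
    have hy' : ‖y‖ < 1 := by
      rw [← ENNReal.ofReal_one, Metric.eball_ofReal] at hy
      simpa using hy
    have := h (Complex.UnitDisc.mk y hy')
    rw [← diskExt_coe f, Complex.UnitDisc.coe_mk] at this
    simpa [coeffSeries] using this

theorem isHolo_of_hasSum [CompleteSpace E] {f : 𝔻 → E} {a : ℕ → E}
    (h : ∀ z : 𝔻, HasSum (fun n => (z : ℂ) ^ n • a n) (f z)) : IsHolo f := by
  have := (hasFPowerSeriesOnBall_diskExt h).differentiableOn
  rwa [← ENNReal.ofReal_one, Metric.eball_ofReal] at this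

theorem taylorCoeff_of_hasSum [CompleteSpace E] {f : 𝔻 → E} {a : ℕ → E}
    (h : ∀ z : 𝔻, HasSum (fun n => (z : ℂ) ^ n • a n) (f z)) (n : ℕ) : taylorCoeff f n = a n := by
  have := (hasFPowerSeriesOnBall_diskExt h).factorial_smul (1 : ℂ) n
  rw [taylorCoeff, iteratedDeriv_eq_iteratedFDeriv, ← this, ← Nat.cast_smul_eq_nsmul ℂ,
    inv_smul_smul₀ (by exact_mod_cast n.factorial_ne_zero)]
  simp [coeffSeries]

theorem summable_norm_mul_pow_of_hasSum {f : 𝔻 → E} {a : ℕ → E}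
    (h : ∀ z : 𝔻, HasSum (fun n => (z : ℂ) ^ n • a n) (f z)) {r : ℝ} (h0 : 0 ≤ r) (h1 : r < 1) :
    Summable fun n => ‖(r : ℂ) ^ n • a n‖ := by
  lift r to NNReal using h0
  have := (coeffSeries a).summable_norm_mul_pow (r := r)
    (lt_of_lt_of_le (by exact_mod_cast h1) (one_le_radius_coeffSeries h))
  simpa [coeffSeries, norm_smul, mul_comm] using this

end Taylor

section Parseval

open MeasureTheory Real

variable {E : Type*} [NormedAddCommGroup E] [InnerProductSpace ℂ E] [CompleteSpace E]

theorem integral_exp_mul_I_conj_mul (m n : ℕ) :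
    ∫ θ in (0 : ℝ)..2 * π, starRingEnd ℂ (Complex.exp (n * θ * Complex.I)) *
      Complex.exp (m * θ * Complex.I) = if m = n then (2 * π : ℂ) else 0 := by
  have h : ∀ θ : ℝ, starRingEnd ℂ (Complex.exp (n * θ * Complex.I)) *
      Complex.exp (m * θ * Complex.I) = Complex.exp (((m : ℂ) - n) * Complex.I * θ) := by
    intro θ
    rw [← Complex.exp_conj, ← Complex.exp_add]
    congr 1
    simp
    ring
  simp_rw [h]
  split_ifs with hmn
  · simp [hmn]
  · have hne : ((m : ℂ) - n) * Complex.I ≠ 0 :=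
      mul_ne_zero (sub_ne_zero.2 (by exact_mod_cast hmn)) Complex.I_ne_zero
    rw [integral_exp_mul_complex hne]
    have : Complex.exp (((m : ℂ) - n) * Complex.I * ((2 * π : ℝ) : ℂ)) = 1 := by
      rw [Complex.exp_eq_one_iff]
      exact ⟨(m : ℤ) - n, by push_cast; ring⟩
    rw [this]
    simp

/-- Parseval's identity for an absolutely convergent Fourier series with vector coefficients. -/
theorem hasSum_norm_sq_circle {c : ℕ → E} (hc : Summable fun n => ‖c n‖) {F : ℝ → E}
    (hF : ∀ θ : ℝ, HasSum (fun n : ℕ => Complex.exp (n * θ * Complex.I) • c n) (F θ)) :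
    Continuous F ∧ HasSum (fun n => 2 * π * ‖c n‖ ^ 2) (∫ θ in (0 : ℝ)..2 * π, ‖F θ‖ ^ 2) := by
  have hnorm : ∀ (n : ℕ) (θ : ℝ), ‖Complex.exp (n * θ * Complex.I) • c n‖ = ‖c n‖ := by
    intro n θ
    have := Complex.norm_exp_ofReal_mul_I (n * θ)
    push_cast at this
    rw [norm_smul, this, one_mul]
  have hcont : Continuous F := by
    have : F = fun θ : ℝ => ∑' n : ℕ, Complex.exp (n * θ * Complex.I) • c n := by
      ext θ; exact (hF θ).tsum_eq.symm
    rw [this]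
    exact continuous_tsum (fun n => by fun_prop) hc fun n θ => (hnorm n θ).le
  refine ⟨hcont, ?_⟩
  have hbd : ∀ θ, ‖F θ‖ ≤ ∑' n, ‖c n‖ := by
    intro θ
    rw [← (hF θ).tsum_eq]
    exact tsum_of_norm_bounded hc.hasSum fun n => (hnorm n θ).le
  -- the inner product with one term of the series
  have h1 : ∀ n : ℕ, ∫ θ in (0 : ℝ)..2 * π, inner ℂ (Complex.exp (n * θ * Complex.I) • c n) (F θ)
      = 2 * π * ‖c n‖ ^ 2 := by
    intro n
    have := intervalIntegral.hasSum_integral_of_dominated_convergence (μ := volume)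
      (a := 0) (b := 2 * π)
      (F := fun (m : ℕ) (θ : ℝ) => inner ℂ (Complex.exp (n * θ * Complex.I) • c n)
        (Complex.exp (m * θ * Complex.I) • c m))
      (f := fun θ => inner ℂ (Complex.exp (n * θ * Complex.I) • c n) (F θ))
      (fun m _ => ‖c n‖ * ‖c m‖)
      (fun m => Continuous.aestronglyMeasurable (by fun_prop))
      (fun m => ae_of_all _ fun θ _ => (norm_inner_le_norm _ _).trans
        (by rw [hnorm, hnorm]))
      (ae_of_all _ fun θ _ => hc.mul_left _)
      intervalIntegrable_const
      (ae_of_all _ fun θ _ => (hF θ).mapL (innerSL ℂ (Complex.exp (n * θ * Complex.I) • c n)))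
    refine this.unique ?_
    simp_rw [inner_smul_left, inner_smul_right, ← mul_assoc, intervalIntegral.integral_mul_const,
      integral_exp_mul_I_conj_mul]
    convert! hasSum_ite_eq n (2 * π * (‖c n‖ : ℂ) ^ 2) using 2 with m
    split_ifs with hmn
    · rw [hmn, inner_self_eq_norm_sq_to_K]; rfl
    · simp
  have h2 := intervalIntegral.hasSum_integral_of_dominated_convergence (μ := volume)
      (a := 0) (b := 2 * π)
      (F := fun (n : ℕ) (θ : ℝ) => inner ℂ (Complex.exp (n * θ * Complex.I) • c n) (F θ))
      (f := fun θ => inner ℂ (F θ) (F θ))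
      (fun n _ => ‖c n‖ * ∑' m, ‖c m‖)
      (fun n => Continuous.aestronglyMeasurable (by fun_prop))
      (fun n => ae_of_all _ fun θ _ => (norm_inner_le_norm _ _).trans (by
        rw [hnorm]; exact mul_le_mul_of_nonneg_left (hbd θ) (norm_nonneg _)))
      (ae_of_all _ fun θ _ => hc.mul_right _)
      intervalIntegrable_const
      (ae_of_all _ fun θ _ => by
        have := ((hF θ).mapL (innerSL ℂ (F θ))).star
        simpa [mul_comm] using this)
  simp_rw [h1, inner_self_eq_norm_sq_to_K] at h2
  have h3 : ∫ θ in (0 : ℝ)..2 * π, ((‖F θ‖ : ℂ)) ^ 2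
      = ((∫ θ in (0 : ℝ)..2 * π, ‖F θ‖ ^ 2 : ℝ) : ℂ) := by
    rw [← intervalIntegral.integral_ofReal]; push_cast; rfl
  rw [← Complex.hasSum_ofReal, ← h3]
  push_cast
  exact h2

variable {E' : Type*} [NormedAddCommGroup E'] [InnerProductSpace ℂ E'] [CompleteSpace E']

/-- Pointwise domination on the disk implies domination of the `H²`-norms: by Parseval this holds
on every circle of radius `r < 1`, and `r` tends to `1`. -/
theorem summable_and_tsum_le_of_norm_le {f : 𝔻 → E} {g : 𝔻 → E'} {a : ℕ → E} {b : ℕ → E'}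
    (hf : ∀ z : 𝔻, HasSum (fun n => (z : ℂ) ^ n • a n) (f z))
    (hg : ∀ z : 𝔻, HasSum (fun n => (z : ℂ) ^ n • b n) (g z))
    (hle : ∀ z, ‖f z‖ ≤ ‖g z‖) (hb : Summable fun n => ‖b n‖ ^ 2) :
    (Summable fun n => ‖a n‖ ^ 2) ∧ ∑' n, ‖a n‖ ^ 2 ≤ ∑' n, ‖b n‖ ^ 2 := by
  have key : ∀ r : ℝ, 0 ≤ r → r < 1 → ∀ s : Finset ℕ,
      ∑ n ∈ s, ‖(r : ℂ) ^ n • a n‖ ^ 2 ≤ ∑' n, ‖b n‖ ^ 2 := by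
    intro r h0 h1 s
    have hmem : ∀ θ : ℝ, ‖(r : ℂ) * Complex.exp (θ * Complex.I)‖ < 1 := by
      intro θ
      rw [norm_mul, Complex.norm_exp_ofReal_mul_I, mul_one, Complex.norm_real, norm_of_nonneg h0]
      exact h1
    have hpow : ∀ (θ : ℝ) (n : ℕ), ((r : ℂ) * Complex.exp (θ * Complex.I)) ^ n
        = Complex.exp (n * θ * Complex.I) * (r : ℂ) ^ n := by
      intro θ n
      rw [mul_pow, ← Complex.exp_nat_mul, mul_comm, mul_assoc]
    obtain ⟨c1, p1⟩ := hasSum_norm_sq_circle (summable_norm_mul_pow_of_hasSum hf h0 h1)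
      (F := fun θ => f (Complex.UnitDisc.mk _ (hmem θ))) (fun θ => by
        simpa [hpow, mul_smul] using hf (Complex.UnitDisc.mk _ (hmem θ)))
    obtain ⟨c2, p2⟩ := hasSum_norm_sq_circle (summable_norm_mul_pow_of_hasSum hg h0 h1)
      (F := fun θ => g (Complex.UnitDisc.mk _ (hmem θ))) (fun θ => by
        simpa [hpow, mul_smul] using hg (Complex.UnitDisc.mk _ (hmem θ)))
    have hpi : (0 : ℝ) < 2 * π := by positivity
    have h3 : ∫ θ in (0 : ℝ)..2 * π, ‖f (Complex.UnitDisc.mk _ (hmem θ))‖ ^ 2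
        ≤ ∫ θ in (0 : ℝ)..2 * π, ‖g (Complex.UnitDisc.mk _ (hmem θ))‖ ^ 2 := by
      refine intervalIntegral.integral_mono_on hpi.le
        ((c1.norm.pow 2).intervalIntegrable _ _) ((c2.norm.pow 2).intervalIntegrable _ _)
        fun θ _ => ?_
      have := hle (Complex.UnitDisc.mk _ (hmem θ))
      gcongr
    have h4 : ∫ θ in (0 : ℝ)..2 * π, ‖g (Complex.UnitDisc.mk _ (hmem θ))‖ ^ 2
        ≤ 2 * π * ∑' n, ‖b n‖ ^ 2 := by
      refine hasSum_le (fun n => ?_) p2 (hb.hasSum.mul_left (2 * π))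
      have : ‖(r : ℂ) ^ n • b n‖ ≤ ‖b n‖ := by
        rw [norm_smul, norm_pow, Complex.norm_real, norm_of_nonneg h0]
        exact mul_le_of_le_one_left (norm_nonneg _) (pow_le_one₀ h0 h1.le)
      gcongr
    have h5 := sum_le_hasSum s (fun n _ => by positivity) p1
    rw [← Finset.mul_sum] at h5
    exact le_of_mul_le_mul_left (h5.trans (h3.trans h4)) hpi
  have key2 : ∀ s : Finset ℕ, ∑ n ∈ s, ‖a n‖ ^ 2 ≤ ∑' n, ‖b n‖ ^ 2 := by
    intro s
    have hc : Continuous fun r : ℝ => ∑ n ∈ s, ‖(r : ℂ) ^ n • a n‖ ^ 2 := by fun_prop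
    have ht := (hc.tendsto 1).mono_left (nhdsWithin_le_nhds (s := Set.Iio 1))
    simp only [Complex.ofReal_one, one_pow, one_smul] at ht
    refine le_of_tendsto ht ?_
    filter_upwards [Ioo_mem_nhdsLT (show (0 : ℝ) < 1 by norm_num)] with r hr
    exact key r hr.1.le hr.2 s
  have hsum : Summable fun n => ‖a n‖ ^ 2 :=
    summable_of_sum_le (fun n => by positivity) key2
  exact ⟨hsum, hsum.tsum_le_of_sum_le key2⟩

end Parseval

/-! ### The Hardy space and multiplication by Schur functions -/

section Hardy

variable {E : Type*} [NormedAddCommGroup E] [InnerProductSpace ℂ E] [CompleteSpace E]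

theorem isHolo_ev (a : Ell2 E) : IsHolo fun z => ev z a :=
  isHolo_of_hasSum fun z => hasSum_ev z a

theorem taylorCoeff_ev (a : Ell2 E) (n : ℕ) : taylorCoeff (fun z => ev z a) n = a n :=
  taylorCoeff_of_hasSum (fun z => hasSum_ev z a) n

/-- Evaluations separate points, by uniqueness of Taylor coefficients. -/
theorem ev_ext {a b : Ell2 E} (h : ∀ z, ev z a = ev z b) : a = b := by
  ext n
  rw [← taylorCoeff_ev a, ← taylorCoeff_ev b, funext h]

theorem h2NormSq_ev (a : Ell2 E) : h2NormSq (fun z => ev z a) = ‖a‖ ^ 2 := by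
  rw [h2NormSq, Ell2.norm_sq]
  simp_rw [taylorCoeff_ev]

/-- The Hardy space `H²(E)` consists of the functions with coefficients in `ℓ²`. -/
theorem memH2_iff {f : 𝔻 → E} : MemH2 f ↔ ∃ a : Ell2 E, f = fun z => ev z a := by
  constructor
  · rintro ⟨hf, hs⟩
    refine ⟨⟨taylorCoeff f, memℓp_two_iff.2 hs⟩, funext fun z => ?_⟩
    exact (hf.hasSum_taylorCoeff z).unique (hasSum_ev z _)
  · rintro ⟨a, rfl⟩
    refine ⟨isHolo_ev a, ?_⟩
    simp_rw [taylorCoeff_ev]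
    exact (Ell2.hasSum_norm_sq a).summable

/-- The difference quotient corresponds to the adjoint of the forward shift. -/
theorem backwardShift_ev (a : Ell2 E) :
    backwardShift (fun z => ev z a) = fun z => ev z (adjoint fwd a) := by
  funext z
  rw [backwardShift]
  by_cases hz : z = 0
  · subst hz
    rw [Complex.UnitDisc.coe_zero, dslope_same, ← iteratedDeriv_one, ev_zero, adjoint_fwd_apply,
      ← taylorCoeff_ev a]
    simp [taylorCoeff]
  · have hz' : (z : ℂ) ≠ 0 := by simpa using hz
    have h0 := diskExt_coe (fun z => ev z a) 0
    rw [Complex.UnitDisc.coe_zero] at h0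
    rw [dslope_of_ne _ hz', slope_def_module, diskExt_coe, h0, ev_zero, sub_zero,
      ← ev_resolvent z a, sub_sub_cancel, inv_smul_smul₀ hz']

end Hardy

section Multiplier

variable {U Y : Type*} [NormedAddCommGroup U] [InnerProductSpace ℂ U] [CompleteSpace U]
  [NormedAddCommGroup Y] [InnerProductSpace ℂ Y] [CompleteSpace Y]

/-- `T` is the operator of multiplication by `S`, acting on coefficient sequences. -/
def IsMulOp (S : 𝔻 → U →L[ℂ] Y) (T : Ell2 U →L[ℂ] Ell2 Y) : Prop :=
  ∀ z a, ev z (T a) = S z (ev z a)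

/-- Multiplication by a Schur function is a contraction `H²(U) → H²(Y)`. -/
theorem IsSchur.exists_isMulOp {S : 𝔻 → U →L[ℂ] Y} (hS : IsSchur S) :
    ∃ T : Ell2 U →L[ℂ] Ell2 Y, ‖T‖ ≤ 1 ∧ IsMulOp S T := by
  have key : ∀ a : Ell2 U, ∃ b : Ell2 Y, (∀ z, ev z b = S z (ev z a)) ∧ ‖b‖ ≤ ‖a‖ := by
    intro a
    have hholo : IsHolo fun z => S z (ev z a) := by
      have := DifferentiableOn.clm_apply hS.1 (isHolo_ev a)
      refine DifferentiableOn.congr this fun w hw => ?_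
      have hw' : ‖w‖ < 1 := by simpa using hw
      have h1 := diskExt_coe (fun z => S z (ev z a)) (Complex.UnitDisc.mk w hw')
      have h2 := diskExt_coe S (Complex.UnitDisc.mk w hw')
      have h3 := diskExt_coe (fun z => ev z a) (Complex.UnitDisc.mk w hw')
      rw [Complex.UnitDisc.coe_mk] at h1 h2 h3
      rw [h1, h2, h3]
    obtain ⟨hs, hle⟩ := summable_and_tsum_le_of_norm_le hholo.hasSum_taylorCoeff
      (fun z => hasSum_ev z a) (fun z => by
        simpa using (S z).le_of_opNorm_le (hS.2 z) (ev z a)) (Ell2.hasSum_norm_sq a).summable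
    refine ⟨⟨_, memℓp_two_iff.2 hs⟩, fun z => ?_, ?_⟩
    · exact (hasSum_ev z _).unique (hholo.hasSum_taylorCoeff z)
    · refine le_of_sq_le_sq ?_ (norm_nonneg _)
      rw [Ell2.norm_sq, Ell2.norm_sq]
      exact hle
  choose T hT hn using key
  let T' : Ell2 U →ₗ[ℂ] Ell2 Y :=
    { toFun := T
      map_add' := fun a b => ev_ext fun z => by simp [hT]
      map_smul' := fun c a => ev_ext fun z => by simp [hT] }
  exact ⟨T'.mkContinuous 1 fun a => by rw [one_mul]; exact hn a,
    T'.mkContinuous_norm_le zero_le_one _, fun z a => hT a z⟩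

namespace IsMulOp

variable {S : 𝔻 → U →L[ℂ] Y} {T : Ell2 U →L[ℂ] Ell2 Y}

theorem apply_fwd (hT : IsMulOp S T) (a : Ell2 U) : T (fwd a) = fwd (T a) :=
  ev_ext fun z => by rw [hT, ev_fwd, ev_fwd, map_smul, hT]

theorem ev_apply_cst (hT : IsMulOp S T) (z : 𝔻) (u : U) : ev z (T (cst u)) = S z u := by
  rw [hT, ev_cst]

theorem apply_cst_zero (hT : IsMulOp S T) (u : U) : T (cst u) 0 = S 0 u := by
  rw [← hT.ev_apply_cst, ev_zero]

theorem adjoint_fwd_adjoint (hT : IsMulOp S T) (k : Ell2 Y) :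
    adjoint fwd (adjoint T k) = adjoint T (adjoint fwd k) := by
  apply ext_inner_left ℂ
  intro a
  simp only [adjoint_inner_right, hT.apply_fwd]

theorem adjoint_adjoint_ev (hT : IsMulOp S T) (z : 𝔻) (y : Y) :
    adjoint T (adjoint (ev z) y) = adjoint (ev z) (adjoint (S z) y) := by
  apply ext_inner_left ℂ
  intro a
  simp only [adjoint_inner_right, hT z a]

theorem adjoint_zero_apply (hT : IsMulOp S T) (y : Y) :
    adjoint (S 0) y = adjoint T (cst y) 0 := by
  apply ext_inner_left ℂ
  intro u
  rw [adjoint_inner_right, ← hT.apply_cst_zero, ← adjoint_cst_apply, ← adjoint_cst_apply,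
    adjoint_inner_left, adjoint_inner_right, adjoint_inner_right]

theorem defects_ev (hT : IsMulOp S T) (f : Ell2 Y) :
    defects S (fun z => ev z f) = Set.range fun g => ‖f + T g‖ ^ 2 - ‖g‖ ^ 2 := by
  have h : ∀ g : Ell2 U, h2NormSq (fun z => ev z f + S z (ev z g)) = ‖f + T g‖ ^ 2 := by
    intro g
    rw [← h2NormSq_ev]
    congr 1
    funext z
    rw [map_add, hT]
  ext r
  constructor
  · rintro ⟨g, hg, rfl⟩
    obtain ⟨a, rfl⟩ := memH2_iff.1 hg
    exact ⟨a, by simp only [h, h2NormSq_ev]⟩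
  · rintro ⟨a, rfl⟩
    exact ⟨fun z => ev z a, memH2_iff.2 ⟨a, rfl⟩, by simp only [h, h2NormSq_ev]⟩

variable {H : Type*} [NormedAddCommGroup H] [InnerProductSpace ℂ H] [CompleteSpace H]
  {J : H →L[ℂ] Ell2 Y}

/-- `ℋ(S)` is the range of any `J` complementary to multiplication by `S`. -/
theorem mem_dbrSpace_iff (hT : IsMulOp S T) (hJ : IsComplement T J) {φ : 𝔻 → Y} :
    φ ∈ dbrSpace S ↔ ∃ h, φ = fun z => ev z (J h) := by
  constructor
  · rintro ⟨hφ, hb⟩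
    obtain ⟨f, rfl⟩ := memH2_iff.1 hφ
    rw [hT.defects_ev, hJ.bddAbove_iff] at hb
    obtain ⟨h, rfl⟩ := hb
    exact ⟨h, rfl⟩
  · rintro ⟨h, rfl⟩
    refine ⟨memH2_iff.2 ⟨_, rfl⟩, ?_⟩
    rw [hT.defects_ev, hJ.bddAbove_iff]
    exact ⟨h, rfl⟩

theorem dbrNormSq_eq (hT : IsMulOp S T) (hJ : IsComplement T J) (h : H) :
    dbrNormSq S (fun z => ev z (J h)) = ‖h‖ ^ 2 := by
  rw [dbrNormSq, hT.defects_ev]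
  exact (hJ.isLUB_defect h).csSup_eq (Set.range_nonempty _)

end IsMulOp

/-- The Hilbert space `H`, embedded in `H²(Y)` by `J`, as a space of functions on the disk. -/
@[reducible]
def rkhsOfEmbedding {H : Type*} [NormedAddCommGroup H] [InnerProductSpace ℂ H]
    (J : H →L[ℂ] Ell2 Y) (hJ : Function.Injective J) : RKHS ℂ H 𝔻 Y where
  coeCLM := ContinuousLinearMap.pi fun z => ev z ∘L J
  coeCLM_injective _ _ h := hJ (ev_ext fun z => congrFun h z)

theorem isDBRSpace_rkhsOfEmbedding {H : Type*} [NormedAddCommGroup H] [InnerProductSpace ℂ H]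
    [CompleteSpace H] {S : 𝔻 → U →L[ℂ] Y} {T : Ell2 U →L[ℂ] Ell2 Y} {J : H →L[ℂ] Ell2 Y}
    (hT : IsMulOp S T) (hJ : IsComplement T J) :
    letI := rkhsOfEmbedding J hJ.injective
    IsDBRSpace S H := by
  let := rkhsOfEmbedding J hJ.injective
  refine ⟨?_, fun f => (hT.dbrNormSq_eq hJ f).symm⟩
  ext φ
  rw [hT.mem_dbrSpace_iff hJ]
  exact exists_congr fun h => eq_comm

/-- Every realization of `ℋ(S)` as a Hilbert space of functions embeds in `H²(Y)` as the
complementary space of the range of multiplication by `S`. -/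
theorem IsDBRSpace.exists_isComplement {H : Type*} [NormedAddCommGroup H] [InnerProductSpace ℂ H]
    [CompleteSpace H] [RKHS ℂ H 𝔻 Y] {S : 𝔻 → U →L[ℂ] Y} {T : Ell2 U →L[ℂ] Ell2 Y}
    (hH : IsDBRSpace S H) (hT : IsMulOp S T) (hT1 : ‖T‖ ≤ 1) :
    ∃ J : H →L[ℂ] Ell2 Y, IsComplement T J ∧ ∀ (f : H) (z : 𝔻), f z = ev z (J f) := by
  obtain ⟨M, _, D, hD⟩ := DeBrangesRovnyak.exists_isComplement T hT1
  have hex : ∀ f : H, ∃ a : M, (f : 𝔻 → Y) = fun z => ev z (D a) := fun f =>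
    (hT.mem_dbrSpace_iff hD).1 (hH.1 ▸ ⟨f, rfl⟩)
  choose Φ hΦ using hex
  have hΦn : ∀ f, ‖Φ f‖ = ‖f‖ := by
    intro f
    rw [← sq_eq_sq₀ (norm_nonneg _) (norm_nonneg _), hH.2, hΦ, hT.dbrNormSq_eq hD]
  have hev : ∀ (f : H) (z : 𝔻), ev z (D (Φ f)) = f z := fun f z => (congrFun (hΦ f) z).symm
  let J' : H →ₗ[ℂ] Ell2 Y :=
    { toFun := fun f => D (Φ f)
      map_add' := fun f g => ev_ext fun z => by rw [map_add, hev, hev, hev]; simp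
      map_smul' := fun c f => ev_ext fun z => by
        rw [RingHom.id_apply, map_smul, hev, hev]; simp }
  let J : H →L[ℂ] Ell2 Y := J'.mkContinuous 1 fun f => by
    rw [one_mul, ← hΦn f]
    exact hD.norm_le _
  have hJ : ∀ f, J f = D (Φ f) := fun f => rfl
  refine ⟨J, hD.of_range_eq ?_ ?_ ?_, fun f z => (hev f z).symm⟩
  · intro f g hfg
    apply RKHS.ext
    intro z
    rw [← hev, ← hev, ← hJ, ← hJ, hfg]
  · intro k
    constructor
    · rintro ⟨f, rfl⟩
      exact ⟨Φ f, rfl⟩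
    · rintro ⟨a, rfl⟩
      have : (fun z => ev z (D a)) ∈ dbrSpace S := (hT.mem_dbrSpace_iff hD).2 ⟨a, rfl⟩
      rw [← hH.1] at this
      obtain ⟨f, hf⟩ := this
      exact ⟨f, ev_ext fun z => by rw [hJ, hev]; exact congrFun hf z⟩
  · intro f a hfa
    rw [← hD.injective hfa, hΦn]

end Multiplier

/-! ### The backward shift and the colligation on `ℋ(S)` -/

section Coisometry

variable {H K U Y : Type*} [NormedAddCommGroup H] [InnerProductSpace ℂ H] [CompleteSpace H]
  [NormedAddCommGroup K] [InnerProductSpace ℂ K] [CompleteSpace K]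
  [NormedAddCommGroup U] [InnerProductSpace ℂ U] [CompleteSpace U]
  [NormedAddCommGroup Y] [InnerProductSpace ℂ Y] [CompleteSpace Y]

theorem isCoisometric_of_norm_adjoint {V : H →L[ℂ] K} (h : ∀ x, ‖adjoint V x‖ = ‖x‖) :
    IsCoisometric V := by
  have := ((adjoint V).norm_map_iff_adjoint_comp_self).1 h
  rw [adjoint_adjoint] at this
  exact this

theorem norm_sq_sub_norm_apply_sq (V : H →L[ℂ] K) (x : H) :
    ‖x‖ ^ 2 - ‖V x‖ ^ 2 = RCLike.re (inner ℂ x (x - adjoint V (V x))) := by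
  rw [inner_sub_right, map_sub, inner_self_eq_norm_sq, adjoint_inner_right, inner_self_eq_norm_sq]

namespace IsCoisometric

variable {V : H →L[ℂ] K}

theorem apply_adjoint (hV : IsCoisometric V) (x : K) : V (adjoint V x) = x :=
  DFunLike.congr_fun hV x

/-- For a coisometry `V`, the operator `I - V* V` is the projection onto the kernel of `V`. -/
theorem norm_sub_sq (hV : IsCoisometric V) (x : H) :
    ‖x - adjoint V (V x)‖ ^ 2 = ‖x‖ ^ 2 - ‖V x‖ ^ 2 := by
  rw [norm_sq_sub_norm_apply_sq, ← @inner_self_eq_norm_sq ℂ, inner_sub_left, map_sub,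
    adjoint_inner_left, map_sub, hV.apply_adjoint, sub_self, inner_zero_right, map_zero, sub_zero]

theorem norm_apply_le (hV : IsCoisometric V) (x : H) : ‖V x‖ ≤ ‖x‖ := by
  refine le_of_sq_le_sq ?_ (norm_nonneg _)
  have := hV.norm_sub_sq x
  nlinarith [sq_nonneg ‖x - adjoint V (V x)‖]

end IsCoisometric

omit [CompleteSpace H] [CompleteSpace U] [CompleteSpace Y] in
theorem colligation_apply (A : H →L[ℂ] H) (B : U →L[ℂ] H) (C : H →L[ℂ] Y) (D : U →L[ℂ] Y)
    (h : H) (u : U) : colligation A B C D (WithLp.toLp 2 (h, u))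
      = WithLp.toLp 2 (A h + B u, C h + D u) := rfl

theorem adjoint_colligation_apply (A : H →L[ℂ] H) (B : U →L[ℂ] H) (C : H →L[ℂ] Y)
    (D : U →L[ℂ] Y) (h : H) (y : Y) : adjoint (colligation A B C D) (WithLp.toLp 2 (h, y))
      = WithLp.toLp 2 (adjoint A h + adjoint C y, adjoint B h + adjoint D y) := by
  apply ext_inner_left ℂ
  rintro ⟨h', u'⟩
  rw [adjoint_inner_right, colligation_apply, WithLp.prod_inner_apply, WithLp.prod_inner_apply]
  simp only [inner_add_left, inner_add_right, adjoint_inner_right]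
  ring

omit [InnerProductSpace ℂ H] [CompleteSpace H] [InnerProductSpace ℂ Y] [CompleteSpace Y] in
theorem norm_toLp_sq (h : H) (y : Y) :
    ‖(WithLp.toLp 2 (h, y) : WithLp 2 (H × Y))‖ ^ 2 = ‖h‖ ^ 2 + ‖y‖ ^ 2 :=
  WithLp.prod_norm_sq_eq_of_L2 _

end Coisometry

section Model

variable {H U Y : Type*} [NormedAddCommGroup H] [InnerProductSpace ℂ H] [CompleteSpace H]
  [NormedAddCommGroup U] [InnerProductSpace ℂ U] [CompleteSpace U]
  [NormedAddCommGroup Y] [InnerProductSpace ℂ Y] [CompleteSpace Y]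
  {S : 𝔻 → U →L[ℂ] Y} {T : Ell2 U →L[ℂ] Ell2 Y} {J : H →L[ℂ] Ell2 Y}
  {R : H →L[ℂ] H} {τ : U →L[ℂ] H}

/-- The norm identity behind the isometry of the adjoint colligation on the dense subspace
`ran J* ⊕ Y`. -/
theorem IsMulOp.norm_adjoint_fwd_add_cst (hT : IsMulOp S T) (hJ : IsComplement T J)
    (k : Ell2 Y) (y : Y) :
    ‖adjoint J (fwd k + cst y)‖ ^ 2 + ‖adjoint T (fwd k + cst y) 0‖ ^ 2
      = ‖adjoint J k‖ ^ 2 + ‖y‖ ^ 2 := by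
  have h1 := hJ.norm_adjoint_sq (fwd k + cst y)
  have h2 := hJ.norm_adjoint_sq k
  have h3 := norm_fwd_add_cst_sq (adjoint fwd (adjoint T (fwd k + cst y)))
    (adjoint T (fwd k + cst y) 0)
  rw [fwd_adjoint_fwd_add, hT.adjoint_fwd_adjoint, adjoint_fwd_fwd_add_cst] at h3
  rw [norm_fwd_add_cst_sq] at h1
  linarith

theorem IsMulOp.norm_adjoint_fwd (hT : IsMulOp S T) (hJ : IsComplement T J) (k : Ell2 Y) :
    ‖adjoint J (fwd k)‖ ^ 2 + ‖adjoint T (fwd k) 0‖ ^ 2 = ‖adjoint J k‖ ^ 2 := by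
  simpa using hT.norm_adjoint_fwd_add_cst hJ k 0

/-- The space is invariant under the backward shift, which acts boundedly on it. -/
theorem IsMulOp.exists_backwardShift (hT : IsMulOp S T) (hJ : IsComplement T J) :
    ∃ R : H →L[ℂ] H, ∀ f, J (R f) = adjoint fwd (J f) := by
  obtain ⟨Z, hZ⟩ := exists_comp_adjoint_eq hJ.injective (adjoint J ∘L fwd) (C := 1) (by
    intro k
    rw [one_mul]
    refine le_of_sq_le_sq ?_ (norm_nonneg _)
    have := hT.norm_adjoint_fwd hJ k
    rw [comp_apply]
    nlinarith [sq_nonneg ‖adjoint T (fwd k) 0‖])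
  refine ⟨adjoint Z, fun f => ext_inner_right ℂ fun k => ?_⟩
  rw [← adjoint_inner_right, adjoint_inner_left, hZ, comp_apply, adjoint_inner_right,
    adjoint_inner_left]

/-- The operator `τ : u ↦ R₀ (S u)` is bounded into the space. -/
theorem IsMulOp.exists_tau (hT : IsMulOp S T) (hJ : IsComplement T J) :
    ∃ τ : U →L[ℂ] H, ∀ u, J (τ u) = adjoint fwd (T (cst u)) := by
  obtain ⟨Z, hZ⟩ := exists_comp_adjoint_eq hJ.injective (adjoint cst ∘L adjoint T ∘L fwd)
    (C := 1) (by
    intro k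
    rw [one_mul]
    refine le_of_sq_le_sq ?_ (norm_nonneg _)
    have := hT.norm_adjoint_fwd hJ k
    rw [comp_apply, comp_apply, adjoint_cst_apply]
    nlinarith [sq_nonneg ‖adjoint J (fwd k)‖])
  refine ⟨adjoint Z, fun f => ext_inner_right ℂ fun k => ?_⟩
  rw [← adjoint_inner_right, adjoint_inner_left, hZ, comp_apply, comp_apply, adjoint_inner_right,
    adjoint_inner_right, adjoint_inner_left]

theorem adjoint_apply_adjoint (hR : ∀ f, J (R f) = adjoint fwd (J f)) (k : Ell2 Y) :
    adjoint R (adjoint J k) = adjoint J (fwd k) := by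
  apply ext_inner_left ℂ
  intro f
  rw [adjoint_inner_right, adjoint_inner_right, adjoint_inner_right, hR, adjoint_inner_left]

theorem adjoint_tau_apply_adjoint (hτ : ∀ u, J (τ u) = adjoint fwd (T (cst u))) (k : Ell2 Y) :
    adjoint τ (adjoint J k) = adjoint T (fwd k) 0 := by
  apply ext_inner_left ℂ
  intro u
  rw [adjoint_inner_right, adjoint_inner_right, hτ, adjoint_inner_left, ← adjoint_inner_right,
    ← adjoint_inner_right, adjoint_cst_apply]

/-- The formula `(R₀* f)(z) = z f(z) - S(z) τ* f`, on coefficient sequences. -/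
theorem IsMulOp.apply_adjoint_backwardShift (hT : IsMulOp S T) (hJ : IsComplement T J)
    (hR : ∀ f, J (R f) = adjoint fwd (J f)) (hτ : ∀ u, J (τ u) = adjoint fwd (T (cst u)))
    (f : H) : J (adjoint R f) = fwd (J f) - T (cst (adjoint τ f)) := by
  refine (denseRange_adjoint_of_injective hJ.injective).induction_on
    (p := fun f => J (adjoint R f) = fwd (J f) - T (cst (adjoint τ f))) f ?_ fun k => ?_
  · exact isClosed_eq (by fun_prop) (by fun_prop)
  · rw [adjoint_apply_adjoint hR, adjoint_tau_apply_adjoint hτ]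
    have h1 := hJ.adjoint_apply k
    have h2 := hJ.adjoint_apply (fwd k)
    -- split `T* (fwd k)` into its shifted part, which is `fwd (T* k)`, and its constant term
    have h3 := congrArg T (fwd_adjoint_fwd_add (adjoint T (fwd k)))
    rw [hT.adjoint_fwd_adjoint, adjoint_fwd_fwd, map_add, hT.apply_fwd] at h3
    rw [← h3] at h2
    have h4 := congrArg fwd h1
    rw [map_add] at h4
    rw [eq_sub_of_add_eq h4, eq_sub_of_add_eq h2]
    abel

variable {C : H →L[ℂ] Y}

theorem adjoint_eval_apply (hC : ∀ f, C f = J f 0) (y : Y) : adjoint C y = adjoint J (cst y) := by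
  apply ext_inner_left ℂ
  intro f
  rw [adjoint_inner_right, adjoint_inner_right, hC, ← adjoint_inner_left, adjoint_cst_apply]

theorem IsMulOp.isCoisometric_colligation (hT : IsMulOp S T) (hJ : IsComplement T J)
    (hR : ∀ f, J (R f) = adjoint fwd (J f)) (hτ : ∀ u, J (τ u) = adjoint fwd (T (cst u)))
    (hC : ∀ f, C f = J f 0) : IsCoisometric (colligation R τ C (S 0)) := by
  have key : ∀ (h : H) (y : Y), ‖adjoint R h + adjoint C y‖ ^ 2
      + ‖adjoint τ h + adjoint (S 0) y‖ ^ 2 = ‖h‖ ^ 2 + ‖y‖ ^ 2 := by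
    intro h y
    refine (denseRange_adjoint_of_injective hJ.injective).induction_on
      (p := fun h => ‖adjoint R h + adjoint C y‖ ^ 2
        + ‖adjoint τ h + adjoint (S 0) y‖ ^ 2 = ‖h‖ ^ 2 + ‖y‖ ^ 2) h ?_ fun k => ?_
    · exact isClosed_eq (by fun_prop) (by fun_prop)
    · rw [adjoint_apply_adjoint hR, adjoint_tau_apply_adjoint hτ, adjoint_eval_apply hC,
        hT.adjoint_zero_apply, ← hT.norm_adjoint_fwd_add_cst hJ k y, map_add, map_add]
      rfl
  refine isCoisometric_of_norm_adjoint ?_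
  rintro ⟨h, y⟩
  rw [← sq_eq_sq₀ (norm_nonneg _) (norm_nonneg _), adjoint_colligation_apply, norm_toLp_sq,
    norm_toLp_sq]
  exact key h y

theorem norm_adjoint_sq_of_isCoisometric {D : U →L[ℂ] Y}
    (hV : IsCoisometric (colligation R τ C D)) (f : H) :
    ‖adjoint R f‖ ^ 2 = ‖f‖ ^ 2 - ‖adjoint τ f‖ ^ 2 := by
  have h := congrArg (fun x => RCLike.re (inner ℂ x (WithLp.toLp 2 (f, (0 : Y)))))
    (hV.apply_adjoint (WithLp.toLp 2 (f, 0)))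
  rw [← adjoint_inner_right, inner_self_eq_norm_sq, inner_self_eq_norm_sq,
    adjoint_colligation_apply, norm_toLp_sq, norm_toLp_sq] at h
  simp only [map_zero, add_zero, norm_zero] at h
  linarith

theorem norm_sq_le_of_isCoisometric {D : U →L[ℂ] Y}
    (hV : IsCoisometric (colligation R τ C D)) (f : H) :
    ‖R f‖ ^ 2 ≤ ‖f‖ ^ 2 - ‖C f‖ ^ 2 := by
  have h := pow_le_pow_left₀ (norm_nonneg _) (hV.norm_apply_le (WithLp.toLp 2 (f, (0 : U)))) 2
  rw [colligation_apply, norm_toLp_sq, norm_toLp_sq] at h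
  simp only [map_zero, add_zero, norm_zero] at h
  linarith

/-- The colligation vanishes exactly at the pairs `(f, u)` with `f = -S u`. -/
theorem IsMulOp.colligation_eq_zero_iff (hT : IsMulOp S T) (hJ : IsComplement T J)
    (hR : ∀ f, J (R f) = adjoint fwd (J f)) (hτ : ∀ u, J (τ u) = adjoint fwd (T (cst u)))
    (hC : ∀ f, C f = J f 0) (f : H) (u : U) :
    colligation R τ C (S 0) (WithLp.toLp 2 (f, u)) = 0 ↔ J f + T (cst u) = 0 := by
  have h : colligation R τ C (S 0) (WithLp.toLp 2 (f, u)) = 0 ↔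
      R f + τ u = 0 ∧ C f + S 0 u = 0 := by
    rw [colligation_apply]
    constructor
    · intro h
      have := congrArg WithLp.ofLp h
      exact Prod.ext_iff.1 this
    · rintro ⟨h1, h2⟩
      rw [h1, h2]
      rfl
  rw [h, ← map_eq_zero_iff J hJ.injective, map_add, hR, hτ, hC, ← hT.apply_cst_zero, ← map_add]
  constructor
  · rintro ⟨h1, h2⟩
    rw [← fwd_adjoint_fwd_add (J f + T (cst u)), h1]
    change _ + cst (J f 0 + T (cst u) 0) = 0
    rw [h2, map_zero, map_zero, add_zero]
  · intro h1
    refine ⟨by rw [h1, map_zero], ?_⟩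
    exact congrArg (fun a : Ell2 Y => a 0) h1

/-- Equality in the norm inequality means that the kernel of the colligation is orthogonal to
`H ⊕ 0`. -/
theorem IsMulOp.norm_sq_eq_iff (hT : IsMulOp S T) (hJ : IsComplement T J)
    (hR : ∀ f, J (R f) = adjoint fwd (J f)) (hτ : ∀ u, J (τ u) = adjoint fwd (T (cst u)))
    (hC : ∀ f, C f = J f 0) :
    (∀ f, ‖R f‖ ^ 2 = ‖f‖ ^ 2 - ‖C f‖ ^ 2) ↔
      ∀ u, (fun z => S z u) ∈ dbrSpace S → ∀ z, S z u = 0 := by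
  have hV := hT.isCoisometric_colligation hJ hR hτ hC
  have hnorm : ∀ f, ‖colligation R τ C (S 0) (WithLp.toLp 2 (f, 0))‖ ^ 2
      = ‖R f‖ ^ 2 + ‖C f‖ ^ 2 := by
    intro f
    rw [colligation_apply, norm_toLp_sq, map_zero, map_zero, add_zero, add_zero]
  have hnorm' : ∀ f : H, ‖(WithLp.toLp 2 (f, 0) : WithLp 2 (H × U))‖ ^ 2 = ‖f‖ ^ 2 := by
    intro f
    rw [norm_toLp_sq, norm_zero]
    ring
  constructor
  · intro h u hu
    obtain ⟨f, hf⟩ := (hT.mem_dbrSpace_iff hJ).1 hu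
    have hJf : J f + T (cst (-u)) = 0 := ev_ext fun z => by
      rw [map_add, hT.ev_apply_cst, map_neg, map_zero, ← congrFun hf z, add_neg_cancel]
    rw [← hT.colligation_eq_zero_iff hJ hR hτ hC] at hJf
    -- `(f, 0)` lies in the range of the adjoint, which is orthogonal to `(f, -u)`
    have h1 := hV.norm_sub_sq (WithLp.toLp 2 (f, 0))
    rw [hnorm, hnorm', h f, sub_add_cancel, sub_self, sq_eq_zero_iff, norm_eq_zero,
      sub_eq_zero] at h1
    have h2 : inner ℂ (WithLp.toLp 2 (f, -u) : WithLp 2 (H × U)) (WithLp.toLp 2 (f, 0)) = 0 := by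
      rw [h1, adjoint_inner_right, hJf, inner_zero_left]
    rw [WithLp.prod_inner_apply] at h2
    simp only [inner_zero_right, add_zero, inner_self_eq_zero] at h2
    intro z
    have := congrFun hf z
    simp only [h2, map_zero] at this
    exact this
  · intro h f
    have h1 := norm_sq_sub_norm_apply_sq (colligation R τ C (S 0)) (WithLp.toLp 2 (f, 0))
    have h2 : colligation R τ C (S 0) (WithLp.toLp 2 (f, 0) - adjoint (colligation R τ C (S 0))
        (colligation R τ C (S 0) (WithLp.toLp 2 (f, 0)))) = 0 := by
      rw [map_sub, hV.apply_adjoint, sub_self]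
    rw [hnorm, hnorm'] at h1
    revert h1 h2
    generalize (WithLp.toLp 2 (f, 0) - adjoint (colligation R τ C (S 0))
        (colligation R τ C (S 0) (WithLp.toLp 2 (f, 0)))) = x
    obtain ⟨f', u'⟩ := x
    intro h1 h2
    rw [hT.colligation_eq_zero_iff hJ hR hτ hC] at h2
    have h3 : ∀ z, S z u' = ev z (J (-f')) := by
      intro z
      rw [← hT.ev_apply_cst, map_neg, ← eq_neg_of_add_eq_zero_right h2]
    have h4 := h u' ((hT.mem_dbrSpace_iff hJ).2 ⟨-f', funext h3⟩)
    have h5 : f' = 0 := by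
      rw [← neg_eq_zero]
      apply hJ.injective
      refine ev_ext fun z => ?_
      rw [← h3, h4, map_zero, map_zero]
    -- `(f, 0)` is orthogonal to `(0, u')`
    rw [h5, WithLp.prod_inner_apply] at h1
    simp only [inner_zero_left, inner_zero_right, add_zero, map_zero] at h1
    linarith

omit [CompleteSpace H] in
theorem IsMulOp.eq_charFun (hT : IsMulOp S T)
    (hR : ∀ f, J (R f) = adjoint fwd (J f)) (hτ : ∀ u, J (τ u) = adjoint fwd (T (cst u)))
    (hC : ∀ f, C f = J f 0) (z : 𝔻) (hz : IsUnit (1 - (z : ℂ) • R)) :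
    S z = charFun R τ C (S 0) (z : ℂ) := by
  ext u
  -- evaluating `J` of the resolvent equation at `z` leaves only the constant term of `h`
  set h := Ring.inverse (1 - (z : ℂ) • R) (τ u)
  have h1 : h - (z : ℂ) • R h = τ u :=
    DFunLike.congr_fun (Ring.mul_inverse_cancel _ hz) (τ u)
  have h2 := congrArg (fun f => ev z (J f)) h1
  simp only [map_sub, map_smul, hR, hτ] at h2
  rw [ev_resolvent, ← hC] at h2
  have h3 := ev_resolvent z (T (cst u))
  rw [hT.ev_apply_cst, hT.apply_cst_zero, ← h2] at h3
  change S z u = S 0 u + (z : ℂ) • C h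
  rw [← h3]
  abel

omit [CompleteSpace H] in
/-- Orbits of the backward shift along which the norm is constant consist of functions all of whose
Taylor coefficients vanish. -/
theorem isCNIContraction_of_norm_sq_le (hJ : Function.Injective J)
    (hR : ∀ f, J (R f) = adjoint fwd (J f)) (hC : ∀ f, C f = J f 0)
    (hle : ∀ f, ‖R f‖ ^ 2 ≤ ‖f‖ ^ 2 - ‖C f‖ ^ 2) : IsCNIContraction R := by
  constructor
  · refine opNorm_le_bound _ zero_le_one fun f => ?_
    rw [one_mul]
    refine le_of_sq_le_sq ?_ (norm_nonneg _)
    nlinarith [hle f, sq_nonneg ‖C f‖]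
  · refine Set.eq_singleton_iff_unique_mem.2 ⟨by simp, fun f hf => ?_⟩
    have hf' : ∀ n, ‖(R ^ n) f‖ = ‖f‖ := fun n => Set.mem_iInter.1 hf n
    have hJn : ∀ n, J ((R ^ n) f) = ((adjoint fwd) ^ n) (J f) := by
      intro n
      induction n with
      | zero => rfl
      | succ n ih =>
        rw [pow_succ', pow_succ']
        change J (R ((R ^ n) f)) = adjoint fwd (((adjoint fwd) ^ n) (J f))
        rw [hR, ih]
    have hCn : ∀ n, C ((R ^ n) f) = 0 := by
      intro n
      have h1 := hle ((R ^ n) f)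
      have h2 := hf' (n + 1)
      rw [pow_succ'] at h2
      change ‖R ((R ^ n) f)‖ = _ at h2
      rw [h2, hf' n] at h1
      rw [← norm_eq_zero, ← sq_eq_zero_iff]
      nlinarith [sq_nonneg ‖C ((R ^ n) f)‖]
    apply hJ
    rw [map_zero]
    ext n
    have := hCn n
    rw [hC, hJn, adjoint_fwd_pow_apply, add_zero] at this
    exact this

end Model

theorem UnitarilyEquivalent.isCNIContraction {X H : Type*} [NormedAddCommGroup X]
    [InnerProductSpace ℂ X] [NormedAddCommGroup H] [InnerProductSpace ℂ H] {T : X →L[ℂ] X}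
    {R : H →L[ℂ] H} (h : UnitarilyEquivalent T R) (hR : IsCNIContraction R) :
    IsCNIContraction T := by
  obtain ⟨V, hV⟩ := h
  have hn : ∀ n x, V ((T ^ n) x) = (R ^ n) (V x) := by
    intro n x
    induction n with
    | zero => rfl
    | succ n ih =>
      rw [pow_succ', pow_succ']
      change V (T ((T ^ n) x)) = R ((R ^ n) (V x))
      rw [hV, ih]
  constructor
  · refine opNorm_le_bound _ zero_le_one fun x => ?_
    rw [← V.norm_map, hV, ← V.norm_map x]
    exact R.le_of_opNorm_le hR.1 _
  · refine Set.eq_singleton_iff_unique_mem.2 ⟨by simp, fun x hx => ?_⟩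
    have hx' : ∀ n, ‖(T ^ n) x‖ = ‖x‖ := fun n => Set.mem_iInter.1 hx n
    have : V x ∈ ⋂ n : ℕ, {y : H | ‖(R ^ n) y‖ = ‖y‖} :=
      Set.mem_iInter.2 fun n => by
        change ‖(R ^ n) (V x)‖ = ‖V x‖
        rw [← hn, V.norm_map, V.norm_map, hx']
    rw [hR.2] at this
    exact (map_eq_zero_iff V V.injective).1 this

/-! ### Coisometric realizations of completely non-isometric contractions -/

section Realization

variable {H U Y : Type*} [NormedAddCommGroup H] [InnerProductSpace ℂ H] [CompleteSpace H]
  [NormedAddCommGroup U] [InnerProductSpace ℂ U] [CompleteSpace U]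
  [NormedAddCommGroup Y] [InnerProductSpace ℂ Y] [CompleteSpace Y]
  {A : H →L[ℂ] H} {B : U →L[ℂ] H} {C : H →L[ℂ] Y} {D : U →L[ℂ] Y}

theorem IsCoisometric.norm_colligation_le (hV : IsCoisometric (colligation A B C D)) :
    ‖A‖ ≤ 1 := by
  refine opNorm_le_bound _ zero_le_one fun h => ?_
  rw [one_mul]
  refine le_of_sq_le_sq ?_ (norm_nonneg _)
  nlinarith [norm_sq_le_of_isCoisometric hV h, sq_nonneg ‖C h‖]

/-- The characteristic function of a coisometric colligation belongs to the Schur class. -/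
theorem IsCoisometric.isSchur_charFun (hV : IsCoisometric (colligation A B C D)) :
    IsSchur fun z : 𝔻 => charFun A B C D (z : ℂ) := by
  have hA := hV.norm_colligation_le
  constructor
  · have hd : DifferentiableOn ℂ (charFun A B C D) (Metric.ball (0 : ℂ) 1) := by
      intro w hw
      have hw' : ‖w‖ < 1 := by simpa using hw
      have hu := isUnit_one_sub_smul hA (Complex.UnitDisc.mk w hw')
      rw [Complex.UnitDisc.coe_mk] at hu
      have h1 : DifferentiableAt ℂ (fun w : ℂ => Ring.inverse (1 - w • A)) w :=
        DifferentiableAt.comp (g := Ring.inverse) (f := fun w : ℂ => 1 - w • A) w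
          (differentiableAt_inverse hu) (by fun_prop)
      have h2 : DifferentiableAt ℂ (charFun A B C D) w :=
        (differentiableAt_const D).add (differentiableAt_id.smul
          ((differentiableAt_const C).clm_comp (h1.clm_comp (differentiableAt_const B))))
      exact h2.differentiableWithinAt
    refine DifferentiableOn.congr hd fun w hw => ?_
    have hw' : ‖w‖ < 1 := by simpa using hw
    have := diskExt_coe (fun z : 𝔻 => charFun A B C D (z : ℂ)) (Complex.UnitDisc.mk w hw')
    rwa [Complex.UnitDisc.coe_mk] at this
  · intro z
    refine opNorm_le_bound _ zero_le_one fun u => ?_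
    set x := Ring.inverse (1 - (z : ℂ) • A) (B u)
    have h1 : x - (z : ℂ) • A x = B u :=
      DFunLike.congr_fun (Ring.mul_inverse_cancel _ (isUnit_one_sub_smul hA z)) (B u)
    -- the colligation maps `(z x, u)` to `(x, S(z) u)`
    have h2 : colligation A B C D (WithLp.toLp 2 ((z : ℂ) • x, u))
        = WithLp.toLp 2 (x, charFun A B C D (z : ℂ) u) := by
      rw [colligation_apply, map_smul, map_smul, ← h1, add_sub_cancel, add_comm _ (D u)]
      rfl
    have h3 := pow_le_pow_left₀ (norm_nonneg _)
      (hV.norm_apply_le (WithLp.toLp 2 ((z : ℂ) • x, u))) 2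
    rw [h2, norm_toLp_sq, norm_toLp_sq, norm_smul, mul_pow] at h3
    rw [one_mul]
    refine le_of_sq_le_sq ?_ (norm_nonneg _)
    nlinarith [z.sq_norm_lt_one, sq_nonneg ‖x‖]

variable {J : H →L[ℂ] Ell2 Y}

/-- An operator satisfying the recursion of the observability operator `h ↦ (C Aⁿ h)ₙ` sends `h` to
the function `z ↦ C (I - z A)⁻¹ h`. -/
theorem ev_observability (hA : ‖A‖ ≤ 1) (hJ : ∀ h, J h = fwd (J (A h)) + cst (C h)) (z : 𝔻)
    (h : H) : ev z (J h) = C (Ring.inverse (1 - (z : ℂ) • A) h) := by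
  set x := Ring.inverse (1 - (z : ℂ) • A) h
  have h1 : x - (z : ℂ) • A x = h :=
    DFunLike.congr_fun (Ring.mul_inverse_cancel _ (isUnit_one_sub_smul hA z)) h
  rw [← h1, map_sub, map_smul, map_sub, map_smul, hJ x, map_add, ev_fwd, ev_cst,
    add_sub_cancel_left]

/-- If `J` is the injective observability operator of a coisometric colligation, then its range is
complementary to the range of multiplication by the characteristic function. -/
theorem IsCoisometric.isComplement (hV : IsCoisometric (colligation A B C D))
    (hJi : Function.Injective J) (hJ : ∀ h, J h = fwd (J (A h)) + cst (C h))
    {M : Ell2 U →L[ℂ] Ell2 Y} (hM : IsMulOp (fun z : 𝔻 => charFun A B C D (z : ℂ)) M) :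
    IsComplement M J := by
  have hA := hV.norm_colligation_le
  have hMc : ∀ u, M (cst u) = fwd (J (B u)) + cst (D u) := fun u => ev_ext fun z => by
    rw [hM.ev_apply_cst, map_add, ev_fwd, ev_cst, ev_observability hA hJ, add_comm]
    rfl
  have hJadj : ∀ k, adjoint J k = adjoint A (adjoint J (adjoint fwd k)) + adjoint C (k 0) := by
    intro k
    apply ext_inner_left ℂ
    intro h
    rw [adjoint_inner_right, hJ, inner_add_left, inner_add_right, adjoint_inner_right,
      adjoint_inner_right, adjoint_inner_right, adjoint_inner_right, ← adjoint_cst_apply,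
      adjoint_inner_right]
  have hMadj : ∀ k, adjoint M k 0
      = adjoint B (adjoint J (adjoint fwd k)) + adjoint D (k 0) := by
    intro k
    apply ext_inner_left ℂ
    intro u
    rw [← adjoint_cst_apply, adjoint_inner_right, adjoint_inner_right, hMc, inner_add_left,
      inner_add_right, adjoint_inner_right, adjoint_inner_right, adjoint_inner_right,
      adjoint_inner_right, ← adjoint_cst_apply, adjoint_inner_right]
  -- `Q = J J* + M M*` satisfies `Q = cst cst* + fwd Q fwd*`, which forces `Q = I`
  have hQ : ∀ k, J (adjoint J k) + M (adjoint M k)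
      = fwd (J (adjoint J (adjoint fwd k)) + M (adjoint M (adjoint fwd k))) + cst (k 0) := by
    intro k
    have h1 := hV.apply_adjoint (WithLp.toLp 2 (adjoint J (adjoint fwd k), k 0))
    rw [adjoint_colligation_apply, ← hJadj, ← hMadj, colligation_apply] at h1
    have h2 : A (adjoint J k) + B (adjoint M k 0) = adjoint J (adjoint fwd k) :=
      congrArg (fun x => x.fst) h1
    have h3 : C (adjoint J k) + D (adjoint M k 0) = k 0 := congrArg (fun x => x.snd) h1
    have h4 := congrArg M (fwd_adjoint_fwd_add (adjoint M k))
    rw [hM.adjoint_fwd_adjoint, map_add, hM.apply_fwd, hMc] at h4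
    have h5 : fwd (J (adjoint J (adjoint fwd k)))
        = fwd (J (A (adjoint J k))) + fwd (J (B (adjoint M k 0))) := by
      rw [← map_add, ← map_add, h2]
    have h6 : cst (k 0) = cst (C (adjoint J k)) + cst (D (adjoint M k 0)) := by
      rw [← map_add, h3]
    rw [← h4, hJ (adjoint J k), map_add, h5, h6]
    abel
  refine ⟨hJi, fun k => ?_⟩
  have hn : ∀ (n : ℕ) (k : Ell2 Y), (J (adjoint J k) + M (adjoint M k)) n = k n := by
    intro n
    induction n with
    | zero => intro k; rw [hQ]; simp
    | succ n ih =>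
      intro k
      rw [hQ]
      change fwd _ (n + 1) + cst (k 0) (n + 1) = _
      rw [fwd_succ, cst_succ, add_zero, ih, adjoint_fwd_apply]
  ext n
  exact hn n k

end Realization

section CompletelyNonIsometric

variable {X : Type*} [NormedAddCommGroup X] [InnerProductSpace ℂ X] [CompleteSpace X]
  {T : X →L[ℂ] X}

/-- A completely non-isometric contraction has an injective observability operator for an output
operator `C` with `C* C = I - T* T`. -/
theorem IsCNIContraction.exists_observability (hT : IsCNIContraction T) :
    ∃ (C : X →L[ℂ] X) (J : X →L[ℂ] Ell2 X), (∀ x, adjoint T (T x) + adjoint C (C x) = x) ∧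
      Function.Injective J ∧ ∀ x, J x = fwd (J (T x)) + cst (C x) := by
  have hle : ∀ x, ‖T x‖ ≤ ‖x‖ := fun x => by simpa using T.le_of_opNorm_le hT.1 x
  obtain ⟨C, hCs, hC⟩ := exists_mul_self_of_contraction (A := adjoint T ∘L T)
    (by rw [isSelfAdjoint_iff', adjoint_comp, adjoint_adjoint]) (by
      intro x
      rw [comp_apply, adjoint_inner_left, inner_self_eq_norm_sq]
      have := hle x
      gcongr)
  have hTC : ∀ x, adjoint T (T x) + adjoint C (C x) = x := by
    intro x
    rw [hCs, hC, comp_apply, add_sub_cancel]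
  have hn : ∀ x, ‖T x‖ ^ 2 + ‖C x‖ ^ 2 = ‖x‖ ^ 2 := by
    intro x
    have h := congrArg (fun y => RCLike.re (inner ℂ y x)) (hTC x)
    simp only [inner_add_left, map_add, adjoint_inner_left] at h
    rw [inner_self_eq_norm_sq, inner_self_eq_norm_sq, inner_self_eq_norm_sq] at h
    exact h
  have htel : ∀ x N, ∑ n ∈ Finset.range N, ‖C ((T ^ n) x)‖ ^ 2 = ‖x‖ ^ 2 - ‖(T ^ N) x‖ ^ 2 := by
    intro x N
    induction N with
    | zero => simp
    | succ N ih =>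
      rw [Finset.sum_range_succ, ih, pow_succ' T]
      change _ = ‖x‖ ^ 2 - ‖T ((T ^ N) x)‖ ^ 2
      linarith [hn ((T ^ N) x)]
  have hbd : ∀ x N, ∑ n ∈ Finset.range N, ‖C ((T ^ n) x)‖ ^ 2 ≤ ‖x‖ ^ 2 := by
    intro x N
    rw [htel]
    linarith [sq_nonneg ‖(T ^ N) x‖]
  have hs : ∀ x, Summable fun n => ‖C ((T ^ n) x)‖ ^ 2 := fun x =>
    summable_of_sum_range_le (fun n => by positivity) (hbd x)
  let J' : X →ₗ[ℂ] Ell2 X :=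
    { toFun := fun x => ⟨fun n => C ((T ^ n) x), memℓp_two_iff.2 (hs x)⟩
      map_add' := fun x y => by
        ext n
        change C ((T ^ n) (x + y)) = C ((T ^ n) x) + C ((T ^ n) y)
        rw [map_add, map_add]
      map_smul' := fun c x => by
        ext n
        change C ((T ^ n) (c • x)) = c • C ((T ^ n) x)
        rw [map_smul, map_smul] }
  let J : X →L[ℂ] Ell2 X := J'.mkContinuous 1 fun x => by
    rw [one_mul]
    refine le_of_sq_le_sq ?_ (norm_nonneg _)
    rw [Ell2.norm_sq]
    exact (hs x).tsum_le_of_sum_range_le (hbd x)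
  have hJ : ∀ x n, J x n = C ((T ^ n) x) := fun x n => rfl
  refine ⟨C, J, hTC, ?_, ?_⟩
  · rw [injective_iff_map_eq_zero]
    intro x hx
    have h0 : ∀ n, C ((T ^ n) x) = 0 := by
      intro n
      rw [← hJ, hx]
      rfl
    have : x ∈ ⋂ n : ℕ, {x : X | ‖(T ^ n) x‖ = ‖x‖} := by
      refine Set.mem_iInter.2 fun n => ?_
      have h1 := htel x n
      simp only [h0, norm_zero, ne_eq, OfNat.ofNat_ne_zero, not_false_eq_true, zero_pow,
        Finset.sum_const_zero] at h1
      change ‖(T ^ n) x‖ = ‖x‖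
      rw [← sq_eq_sq₀ (norm_nonneg _) (norm_nonneg _)]
      linarith
    rw [hT.2] at this
    exact this
  · intro x
    ext n
    cases n with
    | zero =>
      change J x 0 = fwd (J (T x)) 0 + cst (C x) 0
      rw [hJ, fwd_zero, cst_zero, zero_add]
      rfl
    | succ n =>
      change J x (n + 1) = fwd (J (T x)) (n + 1) + cst (C x) (n + 1)
      rw [hJ, fwd_succ, cst_succ, add_zero, hJ, pow_succ]
      rfl

variable {Y : Type*} [NormedAddCommGroup Y] [InnerProductSpace ℂ Y] [CompleteSpace Y]

/-- An isometric column `W = [T; C]` is completed to a coisometric colligation by the projection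
`I - W W*` onto the orthogonal complement of its range. -/
theorem exists_isCoisometric_colligation {C : X →L[ℂ] Y}
    (h : ∀ x, adjoint T (T x) + adjoint C (C x) = x) :
    ∃ (B : WithLp 2 (X × Y) →L[ℂ] X) (D : WithLp 2 (X × Y) →L[ℂ] Y),
      IsCoisometric (colligation T B C D) := by
  -- `W'` is the adjoint of the column, and `[B; D]` is the projection
  let p : WithLp 2 (X × Y) →L[ℂ] X :=
    (ContinuousLinearMap.fst ℂ X Y).comp
      (WithLp.prodContinuousLinearEquiv 2 ℂ X Y : WithLp 2 (X × Y) →L[ℂ] X × Y)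
  let q : WithLp 2 (X × Y) →L[ℂ] Y :=
    (ContinuousLinearMap.snd ℂ X Y).comp
      (WithLp.prodContinuousLinearEquiv 2 ℂ X Y : WithLp 2 (X × Y) →L[ℂ] X × Y)
  let W' : WithLp 2 (X × Y) →L[ℂ] X := adjoint T ∘L p + adjoint C ∘L q
  let B := p - T ∘L W'
  let D := q - C ∘L W'
  have hW : ∀ v, W' v = adjoint T v.fst + adjoint C v.snd := fun _ => rfl
  have hB : ∀ v, B v = v.fst - T (W' v) := fun _ => rfl
  have hD : ∀ v, D v = v.snd - C (W' v) := fun _ => rfl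
  have hadj : ∀ x y, adjoint B x + adjoint D y
      = WithLp.toLp 2 (x - T (adjoint T x + adjoint C y), y - C (adjoint T x + adjoint C y)) := by
    intro x y
    apply ext_inner_left ℂ
    rintro ⟨x', y'⟩
    rw [inner_add_right, adjoint_inner_right, adjoint_inner_right, hB, hD, hW,
      WithLp.prod_inner_apply]
    simp only [inner_sub_left, inner_sub_right, inner_add_left, inner_add_right, map_add,
      ← adjoint_inner_left, adjoint_adjoint, WithLp.toLp_fst, WithLp.toLp_snd]
    ring
  refine ⟨B, D, ?_⟩
  ext1 v
  obtain ⟨x, y⟩ := v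
  change colligation T B C D (adjoint (colligation T B C D) (WithLp.toLp 2 (x, y))) = _
  rw [adjoint_colligation_apply, hadj, colligation_apply, hB, hD]
  have hW0 : W' (WithLp.toLp 2 (x - T (adjoint T x + adjoint C y),
      y - C (adjoint T x + adjoint C y))) = 0 := by
    rw [hW]
    change adjoint T (x - T (adjoint T x + adjoint C y))
      + adjoint C (y - C (adjoint T x + adjoint C y)) = 0
    have := h (adjoint T x + adjoint C y)
    rw [map_sub, map_sub, sub_add_sub_comm, this, sub_self]
  rw [hW0, map_zero, map_zero, sub_zero, sub_zero]
  change WithLp.toLp 2 (T _ + (x - T _), C _ + (y - C _)) = WithLp.toLp 2 (x, y)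
  rw [add_sub_cancel, add_sub_cancel]

end CompletelyNonIsometric

/-! ### The reproducing kernel and the model -/

section Main

variable {U Y : Type*} [NormedAddCommGroup U] [InnerProductSpace ℂ U] [CompleteSpace U]
  [NormedAddCommGroup Y] [InnerProductSpace ℂ Y] [CompleteSpace Y] {S : 𝔻 → U →L[ℂ] Y}

theorem kernel_eq_dbrKernel {H : Type*} [NormedAddCommGroup H] [InnerProductSpace ℂ H]
    [CompleteSpace H] [RKHS ℂ H 𝔻 Y] {T : Ell2 U →L[ℂ] Ell2 Y} {J : H →L[ℂ] Ell2 Y}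
    (hT : IsMulOp S T) (hJ : IsComplement T J) (hev : ∀ (f : H) (z : 𝔻), f z = ev z (J f))
    (z w : 𝔻) : RKHS.kernel H z w = dbrKernel S z w := by
  ext y
  have h1 : RKHS.kerFun H w y = adjoint J (adjoint (ev w) y) := by
    apply ext_inner_right ℂ
    intro f
    rw [RKHS.kerFun_inner, hev, adjoint_inner_left, adjoint_inner_left]
  rw [← RKHS.kerFun_apply, h1, hev, eq_sub_of_add_eq (hJ.adjoint_apply _), map_sub, hT,
    hT.adjoint_adjoint_ev, ev_adjoint_ev, ev_adjoint_ev, map_smul, ← smul_sub]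
  rfl

theorem IsSchur.exists_isDBRSpace {U : Type u} {Y : Type v} [NormedAddCommGroup U]
    [InnerProductSpace ℂ U] [CompleteSpace U] [NormedAddCommGroup Y] [InnerProductSpace ℂ Y]
    [CompleteSpace Y] {S : 𝔻 → U →L[ℂ] Y} (hS : IsSchur S) :
    ∃ (H : Type v) (_ : NormedAddCommGroup H) (_ : InnerProductSpace ℂ H)
      (_ : CompleteSpace H) (_ : RKHS ℂ H 𝔻 Y), IsDBRSpace S H := by
  obtain ⟨T, hT1, hT⟩ := hS.exists_isMulOp
  obtain ⟨M, hM, J, hJ⟩ := exists_isComplement T hT1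
  exact ⟨M, inferInstance, inferInstance, hM, rkhsOfEmbedding J hJ.injective,
    isDBRSpace_rkhsOfEmbedding hT hJ⟩

/-- A completely non-isometric contraction is itself the backward shift in a suitable
realization of its state space as a de Branges–Rovnyak space. -/
theorem IsCNIContraction.exists_model {X : Type t} [NormedAddCommGroup X] [InnerProductSpace ℂ X]
    [CompleteSpace X] {T : X →L[ℂ] X} (hT : IsCNIContraction T) :
    ∃ (S : 𝔻 → WithLp 2 (X × X) →L[ℂ] X) (_ : IsSchur S) (_ : RKHS ℂ X 𝔻 X),
      IsDBRSpace S X ∧ IsBackwardShift T := by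
  obtain ⟨C, J, hTC, hJi, hJ⟩ := hT.exists_observability
  obtain ⟨B, D, hV⟩ := exists_isCoisometric_colligation hTC
  have hS := hV.isSchur_charFun
  obtain ⟨M, -, hM⟩ := hS.exists_isMulOp
  refine ⟨_, hS, rkhsOfEmbedding J hJi,
    isDBRSpace_rkhsOfEmbedding hM (hV.isComplement hJi hJ hM), fun x => ?_⟩
  change (fun z => ev z (J (T x))) = backwardShift fun z => ev z (J x)
  rw [backwardShift_ev, hJ x, adjoint_fwd_fwd_add_cst]

end Main

end

end DeBrangesRovnyak

theorem theorem2p1 :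
    (∀ (U : Type u) [NormedAddCommGroup U] [InnerProductSpace ℂ U] [CompleteSpace U]
      (Y : Type v) [NormedAddCommGroup Y] [InnerProductSpace ℂ Y] [CompleteSpace Y]
      (S : 𝔻 → U →L[ℂ] Y), IsSchur S →
      -- `ℋ(S)` is a linear space and a reproducing kernel Hilbert space
      (∃ (H : Type v) (_ : NormedAddCommGroup H) (_ : InnerProductSpace ℂ H)
        (_ : CompleteSpace H) (_ : RKHS ℂ H 𝔻 Y), IsDBRSpace S H) ∧
      -- in the following, `H` is `ℋ(S)` with its Hilbert space structure
      (∀ (H : Type w) [NormedAddCommGroup H] [InnerProductSpace ℂ H] [CompleteSpace H]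
        [RKHS ℂ H 𝔻 Y], IsDBRSpace S H →
        -- the reproducing kernel
        (∀ z w : 𝔻, RKHS.kernel H z w = dbrKernel S z w) ∧
        ∃ (R₀ : H →L[ℂ] H) (τ : U →L[ℂ] H),
          -- the backward shift
          IsBackwardShift R₀ ∧
          (∀ f : H, ‖R₀ f‖ ^ 2 ≤ ‖f‖ ^ 2 - ‖f 0‖ ^ 2) ∧
          ((∀ f : H, ‖R₀ f‖ ^ 2 = ‖f‖ ^ 2 - ‖f 0‖ ^ 2) ↔
            ∀ u : U, (fun z => S z u) ∈ dbrSpace S → ∀ z, S z u = 0) ∧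
          -- the operator `τ` and the adjoint of the backward shift
          (∀ u : U, ((τ u : H) : 𝔻 → Y) = backwardShift fun z => S z u) ∧
          (∀ (f : H) (z : 𝔻), (ContinuousLinearMap.adjoint R₀ f : H) z
            = (z : ℂ) • f z - S z (ContinuousLinearMap.adjoint τ f)) ∧
          (∀ f : H, ‖ContinuousLinearMap.adjoint R₀ f‖ ^ 2
            = ‖f‖ ^ 2 - ‖ContinuousLinearMap.adjoint τ f‖ ^ 2) ∧
          -- the colligation and its characteristic function
          IsCoisometric (colligation R₀ τ (evalAt H 0) (S 0)) ∧
          (∀ z : 𝔻, IsUnit (1 - (z : ℂ) • R₀) ∧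
            S z = charFun R₀ τ (evalAt H 0) (S 0) (z : ℂ)) ∧
          -- operators unitarily equivalent to `R₀` are completely non-isometric contractions
          (∀ (X : Type t) [NormedAddCommGroup X] [InnerProductSpace ℂ X] [CompleteSpace X]
            (T : X →L[ℂ] X), UnitarilyEquivalent T R₀ → IsCNIContraction T))) ∧
    -- characterization of the operators unitarily equivalent to some `R₀`
    (∀ (X : Type t) [NormedAddCommGroup X] [InnerProductSpace ℂ X] [CompleteSpace X]
      (T : X →L[ℂ] X),
      (∃ (U : Type t) (_ : NormedAddCommGroup U) (_ : InnerProductSpace ℂ U)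
        (_ : CompleteSpace U)
        (Y : Type t) (_ : NormedAddCommGroup Y) (_ : InnerProductSpace ℂ Y)
        (_ : CompleteSpace Y) (S : 𝔻 → U →L[ℂ] Y) (_ : IsSchur S)
        (H : Type t) (_ : NormedAddCommGroup H) (_ : InnerProductSpace ℂ H)
        (_ : CompleteSpace H) (_ : RKHS ℂ H 𝔻 Y) (_ : IsDBRSpace S H)
        (R₀ : H →L[ℂ] H), IsBackwardShift R₀ ∧ UnitarilyEquivalent T R₀) ↔
      IsCNIContraction T) := by 
  refine ⟨fun U _ _ _ Y _ _ _ S hS => ⟨hS.exists_isDBRSpace, fun H _ _ _ _ hH => ?_⟩,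
    fun X _ _ _ T => ⟨?_, fun hT => ?_⟩⟩
  · obtain ⟨M, hM1, hM⟩ := hS.exists_isMulOp
    obtain ⟨J, hJ, hev⟩ := hH.exists_isComplement hM hM1
    obtain ⟨R, hR⟩ := hM.exists_backwardShift hJ
    obtain ⟨τ, hτ⟩ := hM.exists_tau hJ
    have hC : ∀ f, evalAt H 0 f = J f 0 := fun f => (hev f 0).trans (ev_zero _)
    have hV := hM.isCoisometric_colligation hJ hR hτ hC
    have hle := norm_sq_le_of_isCoisometric hV
    have hunit := fun z => isUnit_one_sub_smul hV.norm_colligation_le z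
    have hcoe : ∀ f : H, (f : 𝔻 → Y) = fun z => ev z (J f) := fun f => funext (hev f)
    refine ⟨kernel_eq_dbrKernel hM hJ hev, R, τ, ?_, hle, hM.norm_sq_eq_iff hJ hR hτ hC, ?_, ?_,
      norm_adjoint_sq_of_isCoisometric hV, hV,
      fun z => ⟨hunit z, hM.eq_charFun hR hτ hC z (hunit z)⟩, ?_⟩
    · intro f
      rw [hcoe, hcoe, backwardShift_ev, hR]
    · intro u
      have hSu : (fun z => S z u) = fun z => ev z (M (cst u)) :=
        funext fun z => (hM.ev_apply_cst z u).symm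
      rw [hcoe, hτ, hSu, backwardShift_ev]
    · intro f z
      rw [hev, hev, hM.apply_adjoint_backwardShift hJ hR hτ, map_sub, ev_fwd, hM.ev_apply_cst]
    · intro X _ _ _ T hT
      exact hT.isCNIContraction (isCNIContraction_of_norm_sq_le hJ.injective hR hC hle)
  · rintro ⟨U, _, _, _, Y, _, _, _, S, hS, H, _, _, _, _, hH, R, hR, hTR⟩
    obtain ⟨M, hM1, hM⟩ := hS.exists_isMulOp
    obtain ⟨J, hJ, hev⟩ := hH.exists_isComplement hM hM1
    have hcoe : ∀ f : H, (f : 𝔻 → Y) = fun z => ev z (J f) := fun f => funext (hev f)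
    have hR' : ∀ f, J (R f) = ContinuousLinearMap.adjoint fwd (J f) := by
      intro f
      refine ev_ext fun z => ?_
      have h := congrFun (hR f) z
      rw [hcoe, hcoe, backwardShift_ev] at h
      exact h
    obtain ⟨τ, hτ⟩ := hM.exists_tau hJ
    have hC : ∀ f, evalAt H 0 f = J f 0 := fun f => (hev f 0).trans (ev_zero _)
    exact hTR.isCNIContraction (isCNIContraction_of_norm_sq_le hJ.injective hR' hC
      (norm_sq_le_of_isCoisometric (hM.isCoisometric_colligation hJ hR' hτ hC)))
  · obtain ⟨S, hS, _, hX, hR⟩ := hT.exists_model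
    exact ⟨WithLp 2 (X × X), inferInstance, inferInstance, inferInstance, X, inferInstance,
      inferInstance, inferInstance, S, hS, X, inferInstance, inferInstance, inferInstance, _, hX,
      T, hR, LinearIsometryEquiv.refl ℂ X, fun x => rfl⟩
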